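/- **Theorem C.** For $0<\alpha<1$ let $\mathrm{Diff}_+^{1+\alpha}([0,1])$ be the group of orientation-preserving $C^1$-diffeomorphisms $f$ of $[0,1]$ such that the derivatives of $f$ and $f^{-1}$ are $\alpha$-Hölder continuous. For every $0<\alpha<1$ and every integer $d\ge 1$, the group $\mathrm{Diff}_+^{1+\alpha}([0,1])$ contains a metabelian subgroup $\Gamma$ (that is, the second derived subgroup of $\Gamma$ is trivial) that is nilpotent of nilpotence degree exactly $d$. Moreover, $\Gamma$ can be chosen as follows. There are real numbers $p,q>1$ with $S:=\sum_{(i,j)\in\mathbb{Z}^2}\frac{1}{|i|^p+|j|^q+1}<\infty$, and if $I_{i,j}$, $(i,j)\in\mathbb Z^2$, are the closed subintervals of $[0,1]$ of length $\frac{1}{S}\cdot\frac{1}{|i|^p+|j|^q+1}$ joined from left to right in the lexicographic order of the indices $(i,j)$, then $\Gamma$ is generated by elements $f,g_0,\dots,g_{d-1}$ of $\mathrm{Diff}_+^{1+\alpha}([0,1])$ such that, for all $i,j\in\mathbb{Z}$ and $0\le k<d$, $$f(I_{i,j})=I_{i+1,j},\qquad g_k(I_{i,j})=I_{i,\,j+r_k(i)},\qquad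 r_0(i)=1,\quad r_k(i)=\frac{i(i+1)\cdots(i+k-1)}{k!}.$$ -/

import Mathlib

open Set
open scoped unitInterval Nat

noncomputable section

namespace HolderDiff

/-- A self-map of `[0,1]`, seen as a real function on the line: outside `[0,1]` it is extended by
constants, but only its values on `[0,1]` are ever used. -/
def toReal (f : I → I) : ℝ → ℝ := fun x => (f (projIcc 0 1 zero_le_one x) : ℝ)

/-- `f : [0,1] → [0,1]` is of class `C^{1+α}`: it is `C^1` on `[0,1]` (with one-sided derivatives at
the two endpoints) and its derivative is `α`-Hölder continuous. -/
def IsC1Holder (α : ℝ) (f : I → I) : Prop :=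
  ContDiffOn ℝ 1 (toReal f) (Icc 0 1) ∧
    ∃ M : ℝ, ∀ x ∈ Icc (0 : ℝ) 1, ∀ y ∈ Icc (0 : ℝ) 1,
      |derivWithin (toReal f) (Icc 0 1) x - derivWithin (toReal f) (Icc 0 1) y| ≤ M * |x - y| ^ α

theorem mapsTo_toReal (f : I → I) : MapsTo (toReal f) (Icc 0 1) (Icc 0 1) :=
  fun _ _ => (f _).2

theorem toReal_comp (f g : I → I) : toReal (f ∘ g) = toReal f ∘ toReal g := by
  funext x
  simp [toReal]

theorem toReal_id {x : ℝ} (hx : x ∈ Icc (0 : ℝ) 1) : toReal id x = x := by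
  simp [toReal, projIcc_of_mem _ hx]

theorem IsC1Holder.id (α : ℝ) : IsC1Holder α (id : I → I) := by
  refine ⟨contDiffOn_id.congr fun x hx => toReal_id hx, 0, fun x hx y hy => ?_⟩
  have h : ∀ z ∈ Icc (0 : ℝ) 1, derivWithin (toReal _root_.id) (Icc 0 1) z = 1 := fun z hz => by
    rw [derivWithin_congr (f := fun w : ℝ => w) (fun w hw => toReal_id hw) (toReal_id hz)]
    exact derivWithin_id' _ _ (uniqueDiffOn_Icc zero_lt_one z hz)
  simp [h x hx, h y hy]

theorem IsC1Holder.bdd {α : ℝ} {f : I → I} (hf : IsC1Holder α f) :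
    ∃ B : ℝ, 0 ≤ B ∧ ∀ x ∈ Icc (0 : ℝ) 1, |derivWithin (toReal f) (Icc 0 1) x| ≤ B := by
  have hc := hf.1.continuousOn_derivWithin (uniqueDiffOn_Icc zero_lt_one) le_rfl
  obtain ⟨B, hB⟩ := isCompact_Icc.exists_bound_of_continuousOn hc
  exact ⟨B, (abs_nonneg _).trans (hB 0 (by simp)), hB⟩

theorem IsC1Holder.comp {α : ℝ} {f g : I → I} (hf : IsC1Holder α f) (hg : IsC1Holder α g) :
    IsC1Holder α (f ∘ g) := by
  have hu : UniqueDiffOn ℝ (Icc (0 : ℝ) 1) := uniqueDiffOn_Icc zero_lt_one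
  have hfd := hf.1.differentiableOn one_ne_zero
  have hgd := hg.1.differentiableOn one_ne_zero
  obtain ⟨A, hA0, hA⟩ := hf.bdd
  obtain ⟨B, hB0, hB⟩ := hg.bdd
  have hcd : ContDiffOn ℝ 1 (toReal (f ∘ g)) (Icc 0 1) := by
    rw [toReal_comp]
    exact hf.1.comp hg.1 (mapsTo_toReal g)
  have hder : ∀ x ∈ Icc (0 : ℝ) 1, derivWithin (toReal (f ∘ g)) (Icc 0 1) x =
      derivWithin (toReal f) (Icc 0 1) (toReal g x) * derivWithin (toReal g) (Icc 0 1) x := by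
    intro x hx
    rw [toReal_comp]
    exact derivWithin_comp x (hfd _ (mapsTo_toReal g hx)) (hgd x hx) (mapsTo_toReal g)
  refine ⟨hcd, ?_⟩
  rcases lt_or_ge α 0 with hα | hα
  · refine ⟨A * B + A * B, fun x hx y hy => ?_⟩
    rcases eq_or_ne x y with rfl | hxy
    · simp only [sub_self, abs_zero]
      exact mul_nonneg (by positivity) (Real.rpow_nonneg le_rfl _)
    have h1 : (1 : ℝ) ≤ |x - y| ^ α :=
      Real.one_le_rpow_of_pos_of_le_one_of_nonpos (abs_pos.2 (sub_ne_zero.2 hxy))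
        (abs_le.2 ⟨by linarith [hx.1, hy.2], by linarith [hx.2, hy.1]⟩) hα.le
    have h2 : ∀ z ∈ Icc (0 : ℝ) 1, |derivWithin (toReal (f ∘ g)) (Icc 0 1) z| ≤ A * B := by
      intro z hz
      rw [hder z hz, abs_mul]
      exact mul_le_mul (hA _ (mapsTo_toReal g hz)) (hB z hz) (abs_nonneg _) hA0
    calc _ ≤ A * B + A * B := (abs_sub _ _).trans (add_le_add (h2 x hx) (h2 y hy))
      _ ≤ _ := le_mul_of_one_le_right (by positivity) h1
  · obtain ⟨M, hM⟩ := hf.2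
    obtain ⟨N, hN⟩ := hg.2
    refine ⟨|M| * B ^ α * B + A * N, fun x hx y hy => ?_⟩
    have hlip : |toReal g x - toReal g y| ≤ B * |x - y| := by
      have := (convex_Icc (0 : ℝ) 1).norm_image_sub_le_of_norm_derivWithin_le hgd hB hy hx
      simpa using this
    have h1 : |derivWithin (toReal f) (Icc 0 1) (toReal g x) -
        derivWithin (toReal f) (Icc 0 1) (toReal g y)| ≤ |M| * B ^ α * |x - y| ^ α := by
      refine (hM _ (mapsTo_toReal g hx) _ (mapsTo_toReal g hy)).trans ?_
      rw [mul_assoc, ← Real.mul_rpow hB0 (abs_nonneg _)]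
      exact mul_le_mul (le_abs_self M) (Real.rpow_le_rpow (abs_nonneg _) hlip hα)
        (Real.rpow_nonneg (abs_nonneg _) _) (abs_nonneg _)
    rw [hder x hx, hder y hy]
    set a := derivWithin (toReal f) (Icc 0 1) (toReal g x)
    set b := derivWithin (toReal f) (Icc 0 1) (toReal g y)
    have hb : |b| ≤ A := hA _ (mapsTo_toReal g hy)
    set u := derivWithin (toReal g) (Icc 0 1) x
    set v := derivWithin (toReal g) (Icc 0 1) y
    have hR : 0 ≤ |x - y| ^ α := Real.rpow_nonneg (abs_nonneg _) _
    calc |a * u - b * v| = |(a - b) * u + b * (u - v)| := by ring_nf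
      _ ≤ |a - b| * |u| + |b| * |u - v| := by
        rw [← abs_mul, ← abs_mul]; exact abs_add_le _ _
      _ ≤ (|M| * B ^ α * |x - y| ^ α) * B + A * (N * |x - y| ^ α) := by
        refine add_le_add ?_ ?_
        · exact mul_le_mul h1 (hB x hx) (abs_nonneg _) (by positivity)
        · exact mul_le_mul hb (hN x hx y hy) (abs_nonneg _) hA0
      _ = _ := by ring

end HolderDiff

/-- The group `Diff_+^{1+α}([0,1])`, as a subgroup of the group of order isomorphisms (that is,
orientation preserving homeomorphisms) of `[0,1]` under composition: `f` and its inverse are both of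
class `C^{1+α}`. -/
def DiffPlus (α : ℝ) : Subgroup (I ≃o I) where
  carrier := {f | HolderDiff.IsC1Holder α f ∧ HolderDiff.IsC1Holder α f.symm}
  one_mem' := ⟨HolderDiff.IsC1Holder.id α, HolderDiff.IsC1Holder.id α⟩
  mul_mem' := fun ha hb => ⟨ha.1.comp hb.1, hb.2.comp ha.2⟩
  inv_mem' := fun ha => ⟨ha.2, ha.1⟩

/-- A group is metabelian if its second derived subgroup is trivial. -/
def IsMetabelian (G : Type*) [Group G] : Prop := derivedSeries G 2 = ⊥

/-- The number `1 / (|i|^p + |j|^q + 1)`; pairs `(i,j)` are ordered lexicographically. -/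
def blockLength (p q : ℝ) (n : ℤ ×ₗ ℤ) : ℝ :=
  1 / (|((ofLex n).1 : ℝ)| ^ p + |((ofLex n).2 : ℝ)| ^ q + 1)

/-- The sum of all the lengths. -/
def totalLength (p q : ℝ) : ℝ := ∑' n : ℤ ×ₗ ℤ, blockLength p q n

/-- The left endpoint of the interval with index `n`, once the intervals have been joined from left
to right in the lexicographic order and the result has been rescaled to `[0,1]`. -/
def blockLeft (p q : ℝ) (n : ℤ ×ₗ ℤ) : ℝ :=
  (∑' m : Iio n, blockLength p q m) / totalLength p q

/-- The closed interval `I_{i,j}` of `[0,1]`. -/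
def block (p q : ℝ) (i j : ℤ) : Set I :=
  {x | (x : ℝ) ∈ Icc (blockLeft p q (toLex (i, j)))
    (blockLeft p q (toLex (i, j)) + blockLength p q (toLex (i, j)) / totalLength p q)}

/-- The integer `r_k(i) = i (i+1) ⋯ (i+k-1) / k!`, with `r_0(i) = 1` (the division is exact). -/
def risingBinom (k : ℕ) (i : ℤ) : ℤ := (∏ m ∈ Finset.range k, (i + m)) / (k ! : ℤ)

theorem factorial_mul_risingBinom (k : ℕ) (i : ℤ) :
    (k ! : ℤ) * risingBinom k i = ∏ m ∈ Finset.range k, (i + m) := by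
  refine Int.mul_ediv_cancel' ⟨Ring.multichoose i k, ?_⟩
  have h := Ring.factorial_nsmul_multichoose_eq_ascPochhammer i k
  rw [← nsmul_eq_mul, h, Polynomial.ascPochhammer_smeval_eq_eval]
  clear h
  induction k with
  | zero => simp
  | succ k ih => rw [Finset.prod_range_succ, ih, ascPochhammer_succ_eval]

end

/-! The group is first built on the lexicographic product `ℤ ×ₗ ℝ`: the shift is `(i, t) ↦ (i + 1,
t)` and the shears are `(i, t) ↦ (i, t + r_k(i))`. Since the backward difference of `r_{k+1}` is
`r_k`, commuting the shear of `r_{k+1}` with the shift gives exactly the shear of `r_k`. Every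
commutator of such maps is a shear by a function of smaller degree. Shears commute with each other,
so the group is metabelian, and counting degrees gives class exactly `d`.

To transport this action to `[0,1]`, each row `i` is parametrized by a `C^1` increasing chart
sending `[j, j + 1]` onto the interval of index `(i, j)`. The charts embed `ℤ ×ₗ ℝ` densely and
monotonically in `[0,1]`, so order automorphisms extend uniquely and faithfully (`denseExtendHom`).
The group relations hold automatically, the generators permute the intervals as required, and only
regularity remains.

In the chart coordinate the derivative of the image of `skew a P` is the ratio of densities
`ρ_{i+a}(t + P i) / ρ_i(t)`. If it tends to `1` at both ends of each row and is Hölder on each row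
with a uniform constant, it extends by `1` to a Hölder function (`actionDeriv_holder`). The points
outside the rows are countably many in `(0,1)`, so the map is the integral of this extension.

The row estimate is `row_holder`. Take `p = N q` and `τ = 1 + |i|^N + |t|`, so that `ρ_i(t)` is
comparable to `τ^(-q)`. Suppose `ratio - 1` is `O(τ^(-a))` with derivative `O(τ^(-b))`.
Interpolating between the two bounds when `|s - t| ≤ τ/2`, and using decay alone further away, gives
the Hölder bound if `a ≥ α(q-1)` and `a(1-α) + bα ≥ qα`. With `α(q-1) = 1/N` the shift satisfies
this with `a = 1/N`, `b = 1 + 1/N`, with equality in both conditions. The shears satisfy it with `a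
= 1 - (d-1)/N`, `b = 1` once `N` is large. Since `α < 1`, this choice also gives `1/p + 1/q < 1`,
which makes the lengths summable. -/

noncomputable section

namespace HolderDiff

open Filter Topology
open scoped commutatorElement

/-! ### Extension of order automorphisms from a dense suborder -/

section DenseExtension

variable {X : Type*} [LinearOrder X] {Y : Type*} [CompleteLinearOrder Y] {H : X → Y}

/-- The monotone extension along `H : X → Y` of an automorphism of `X`. -/
def denseExtend (H : X → Y) (Φ : X ≃o X) (y : Y) : Y := sSup {w | ∃ z, H z ≤ y ∧ H (Φ z) = w}

theorem denseExtend_mono (H : X → Y) (Φ : X ≃o X) : Monotone (denseExtend H Φ) :=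
  fun _ _ hxy => sSup_le_sSup fun _ ⟨z, hz, hw⟩ => ⟨z, hz.trans hxy, hw⟩

theorem denseExtend_apply (hH : StrictMono H) (Φ : X ≃o X) (z : X) :
    denseExtend H Φ (H z) = H (Φ z) := by
  refine le_antisymm (sSup_le ?_) (le_sSup ⟨z, le_rfl, rfl⟩)
  rintro _ ⟨w, hw, rfl⟩
  exact hH.monotone (Φ.monotone (hH.le_iff_le.1 hw))

theorem denseExtend_mul (hH : StrictMono H) (hd : ∀ x y, x < y → ∃ z, x < H z ∧ H z < y)
    (Φ Ψ : X ≃o X) (y : Y) :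
    denseExtend H (Φ * Ψ) y = denseExtend H Φ (denseExtend H Ψ y) := by
  refine le_antisymm (sSup_le ?_) (sSup_le ?_)
  · rintro _ ⟨z, hz, rfl⟩
    exact le_sSup ⟨Ψ z, le_sSup ⟨z, hz, rfl⟩, rfl⟩
  · rintro _ ⟨w, hw, rfl⟩
    refine le_sSup ⟨Ψ.symm w, ?_, by simp [RelIso.mul_apply]⟩
    -- Density is needed here: a point `H z` strictly between `y` and `H (Ψ⁻¹ w)` would force `w ≤ Ψ
    -- z`, hence `Ψ⁻¹ w ≤ z`.
    by_contra! hlt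
    obtain ⟨z, h1, h2⟩ := hd _ _ hlt
    have h3 : denseExtend H Ψ y ≤ H (Ψ z) := by
      rw [← denseExtend_apply hH]
      exact denseExtend_mono H Ψ h1.le
    have h4 : w ≤ Ψ z := hH.le_iff_le.1 (hw.trans h3)
    have h5 : Ψ.symm w ≤ z := (OrderIso.symm_apply_le Ψ).2 h4
    exact absurd (hH.le_iff_le.2 h5) (not_le.2 h2)

theorem denseExtend_one (hd : ∀ x y, x < y → ∃ z, x < H z ∧ H z < y) (y : Y) :
    denseExtend H 1 y = y := by
  refine le_antisymm (sSup_le ?_) ?_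
  · rintro _ ⟨z, hz, rfl⟩
    exact hz
  · by_contra! hlt
    obtain ⟨z, h1, h2⟩ := hd _ _ hlt
    have h3 : H z ≤ denseExtend H 1 y := le_sSup ⟨z, h2.le, rfl⟩
    exact absurd h3 (not_le.2 h1)

/-- Automorphisms of a dense suborder extend to automorphisms of the completion. -/
def denseExtendHom (hH : StrictMono H) (hd : ∀ x y, x < y → ∃ z, x < H z ∧ H z < y) :
    (X ≃o X) →* (Y ≃o Y) where
  toFun Φ :=
    Equiv.toOrderIso
      { toFun := denseExtend H Φ
        invFun := denseExtend H Φ⁻¹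
        left_inv := fun y => by
          rw [← denseExtend_mul hH hd, inv_mul_cancel, denseExtend_one hd]
        right_inv := fun y => by
          rw [← denseExtend_mul hH hd, mul_inv_cancel, denseExtend_one hd] }
      (denseExtend_mono H Φ) (denseExtend_mono H Φ⁻¹)
  map_one' := by
    ext y
    exact denseExtend_one hd y
  map_mul' Φ Ψ := by
    ext y
    exact denseExtend_mul hH hd Φ Ψ y

theorem denseExtendHom_apply (hH : StrictMono H) (hd : ∀ x y, x < y → ∃ z, x < H z ∧ H z < y)
    (Φ : X ≃o X) (z : X) : denseExtendHom hH hd Φ (H z) = H (Φ z) :=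
  denseExtend_apply hH Φ z

theorem denseExtendHom_injective (hH : StrictMono H)
    (hd : ∀ x y, x < y → ∃ z, x < H z ∧ H z < y) :
    Function.Injective (denseExtendHom hH hd) := by
  intro Φ Ψ h
  ext z
  apply hH.injective
  rw [← denseExtendHom_apply hH hd, h, denseExtendHom_apply]

end DenseExtension

/-! ### Derived and lower central series computed in an ambient group -/

section SubgroupSeries

variable {G G' : Type*} [Group G] [Group G']

/-- Expressing the second derived subgroup by commutators in the ambient group makes it monotone in
`S` and compatible with injective homomorphisms. -/
theorem isMetabelian_iff (S : Subgroup G) : IsMetabelian S ↔ ⁅⁅S, S⁆, ⁅S, S⁆⁆ = ⊥ := by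
  have h : (derivedSeries S 2).map S.subtype = ⁅⁅S, S⁆, ⁅S, S⁆⁆ := by
    simp only [derivedSeries_succ, derivedSeries_zero, Subgroup.map_commutator]
    rw [← MonoidHom.range_eq_map, Subgroup.range_subtype]
  rw [IsMetabelian, ← h, Subgroup.map_eq_bot_iff_of_injective _ S.subtype_injective]

theorem nilpotencyClass_eq_succ {S : Subgroup G} {n : ℕ} (h : S.lowerCentralSeries (n + 1) = ⊥)
    (h' : S.lowerCentralSeries n ≠ ⊥) :
    Group.IsNilpotent S ∧ Group.nilpotencyClass S = n + 1 := by
  have hS : Group.IsNilpotent S := Subgroup.isNilpotent_of_lowerCentralSeries_eq_bot h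
  refine ⟨hS, le_antisymm ?_ ?_⟩
  · rw [← Subgroup.lowerCentralSeries_eq_bot_iff_nilpotencyClass_le,
      ← Subgroup.map_eq_bot_iff_of_injective _ S.subtype_injective,
      Subgroup.top_subtype_lowerCentralSeries, h]
  · by_contra! hlt
    exact h' (Subgroup.lowerCentralSeries_eq_bot_of_nilpotencyClass_le (Nat.lt_succ_iff.1 hlt))

theorem lowerCentralSeries_map_eq_bot_iff {f : G →* G'} (hf : Function.Injective f)
    (S : Subgroup G) (n : ℕ) :
    (S.map f).lowerCentralSeries n = ⊥ ↔ S.lowerCentralSeries n = ⊥ := by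
  rw [← Subgroup.map_lowerCentralSeries, Subgroup.map_eq_bot_iff_of_injective _ hf]

theorem isMetabelian_map_iff {f : G →* G'} (hf : Function.Injective f) (S : Subgroup G) :
    IsMetabelian (S.map f) ↔ IsMetabelian S := by
  rw [isMetabelian_iff, isMetabelian_iff, ← Subgroup.map_commutator, ← Subgroup.map_commutator,
    Subgroup.map_eq_bot_iff_of_injective _ hf]

end SubgroupSeries

/-! ### The model group on `ℤ ×ₗ ℝ`: degree filtration and nilpotency class -/

section Skew

/-- The automorphism `(i, t) ↦ (i + a, t + P i)` of `ℤ × ℝ` with the lexicographic order. -/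
def skew (a : ℤ) (P : ℤ → ℤ) : (ℤ ×ₗ ℝ) ≃o (ℤ ×ₗ ℝ) where
  toFun z := toLex ((ofLex z).1 + a, (ofLex z).2 + P (ofLex z).1)
  invFun z := toLex ((ofLex z).1 - a, (ofLex z).2 - P ((ofLex z).1 - a))
  left_inv z := by simp
  right_inv z := by simp
  map_rel_iff' := by
    intro z w
    simp only [Equiv.coe_fn_mk, Prod.Lex.le_iff, ofLex_toLex, add_lt_add_iff_right,
      add_left_inj]
    refine or_congr_right (and_congr_right fun h => ?_)
    rw [h, add_le_add_iff_right]

theorem skew_apply (a : ℤ) (P : ℤ → ℤ) (i : ℤ) (t : ℝ) :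
    skew a P (toLex (i, t)) = toLex (i + a, t + P i) := rfl

theorem skew_mul (a b : ℤ) (P Q : ℤ → ℤ) :
    skew a P * skew b Q = skew (a + b) (fun i => Q i + P (i + b)) := by
  refine RelIso.ext fun z => ?_
  induction z using Lex.rec with | _ z
  rcases z with ⟨i, t⟩
  rw [RelIso.mul_apply, skew_apply, skew_apply, skew_apply]
  congr 2
  · ring
  · push_cast; ring

theorem skew_zero_zero : skew 0 0 = 1 := by
  refine RelIso.ext fun z => ?_
  induction z using Lex.rec with | _ z
  rcases z with ⟨i, t⟩
  simp [skew_apply]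

theorem skew_inv (a : ℤ) (P : ℤ → ℤ) : (skew a P)⁻¹ = skew (-a) (fun i => -P (i - a)) := by
  rw [inv_eq_iff_mul_eq_one, skew_mul, ← skew_zero_zero]
  congr 1
  · ring
  · funext i; simp [sub_eq_add_neg]

theorem skew_zero_injective : Function.Injective (skew 0) := by
  intro P Q h
  funext i
  have := congrArg (fun Φ => (ofLex (Φ (toLex (i, (0 : ℝ))))).2) h
  simpa [skew_apply] using this

/-- Translation by `b`, acting on functions on `ℤ`. -/
def translate (b : ℤ) : Module.End ℤ (ℤ → ℤ) := LinearMap.funLeft ℤ ℤ (· + b)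

theorem translate_apply (b : ℤ) (P : ℤ → ℤ) (i : ℤ) : translate b P i = P (i + b) := rfl

/-- The backward difference operator. -/
def bwdDiff : Module.End ℤ (ℤ → ℤ) := 1 - translate (-1)

theorem bwdDiff_apply (P : ℤ → ℤ) (i : ℤ) : bwdDiff P i = P i - P (i - 1) := rfl

theorem translate_commute (b c : ℤ) : Commute (translate b) (translate c) := by
  refine LinearMap.ext fun P => funext fun i => ?_
  simp only [Module.End.mul_apply, translate_apply]
  congr 1; ring

theorem bwdDiff_pow_commute (n : ℕ) (b : ℤ) : Commute (bwdDiff ^ n) (translate b) :=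
  ((Commute.one_left _).sub_left (translate_commute _ _)).pow_left n

theorem bwdDiff_pow_translate (n : ℕ) (b : ℤ) (P : ℤ → ℤ) :
    (bwdDiff ^ n) (translate b P) = translate b ((bwdDiff ^ n) P) :=
  LinearMap.congr_fun (bwdDiff_pow_commute n b).eq P

theorem eq_const_of_bwdDiff_eq_zero {Q : ℤ → ℤ} (h : bwdDiff Q = 0) (i : ℤ) : Q i = Q 0 := by
  have h' : ∀ i, Q i = Q (i - 1) := fun i => sub_eq_zero.1 (congrFun h i)
  induction i using Int.induction_on with
  | zero => rfl
  | succ i ih => rw [h', add_sub_cancel_right, ih]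
  | pred i ih => rw [← h', ih]

/-- The `n`-th difference of such a `P` is constant, hence blind to translation: `translate b P - P`
loses one degree. -/
theorem bwdDiff_pow_translate_of_succ {n : ℕ} {P : ℤ → ℤ} (h : (bwdDiff ^ (n + 1)) P = 0) (b : ℤ) :
    (bwdDiff ^ n) (translate b P) = (bwdDiff ^ n) P := by
  rw [bwdDiff_pow_translate]
  rw [pow_succ', Module.End.mul_apply] at h
  funext i
  rw [translate_apply, eq_const_of_bwdDiff_eq_zero h, eq_const_of_bwdDiff_eq_zero h i]

/-- The shears `(i, t) ↦ (i, t + P i)` where `P` is annihilated by the `n`-th difference. -/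
def shears (n : ℕ) : Subgroup ((ℤ ×ₗ ℝ) ≃o (ℤ ×ₗ ℝ)) where
  carrier := {Φ | ∃ P : ℤ → ℤ, (bwdDiff ^ n) P = 0 ∧ Φ = skew 0 P}
  one_mem' := ⟨0, map_zero _, skew_zero_zero.symm⟩
  mul_mem' := by
    rintro _ _ ⟨P, hP, rfl⟩ ⟨Q, hQ, rfl⟩
    refine ⟨Q + P, by rw [map_add, hP, hQ, add_zero], ?_⟩
    rw [skew_mul]
    congr 1
    funext i
    simp
  inv_mem' := by
    rintro _ ⟨P, hP, rfl⟩
    refine ⟨-P, by rw [map_neg, hP, neg_zero], ?_⟩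
    rw [skew_inv]
    congr 1
    funext i
    simp

/-- The transformations `(i, t) ↦ (i + a, t + P i)` where `P` is annihilated by the `n`-th
difference. -/
def skews (n : ℕ) : Subgroup ((ℤ ×ₗ ℝ) ≃o (ℤ ×ₗ ℝ)) where
  carrier := {Φ | ∃ (a : ℤ) (P : ℤ → ℤ), (bwdDiff ^ n) P = 0 ∧ Φ = skew a P}
  one_mem' := ⟨0, 0, map_zero _, skew_zero_zero.symm⟩
  mul_mem' := by
    rintro _ _ ⟨a, P, hP, rfl⟩ ⟨b, Q, hQ, rfl⟩
    refine ⟨a + b, Q + translate b P, ?_, skew_mul a b P Q⟩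
    rw [map_add, bwdDiff_pow_translate, hP, hQ, map_zero, add_zero]
  inv_mem' := by
    rintro _ ⟨a, P, hP, rfl⟩
    refine ⟨-a, -translate (-a) P, ?_, skew_inv a P⟩
    rw [map_neg, bwdDiff_pow_translate, hP, map_zero, neg_zero]

/-- The shift components cancel and `P`, `Q` enter only through differences `Q - translate a Q` and
`translate b P - P`. This single formula yields the drop in degree, the commutation of shears, and
the generators of the central series. -/
theorem commutator_skew (a b : ℤ) (P Q : ℤ → ℤ) :
    ⁅skew a P, skew b Q⁆ =
      skew 0 (translate (-a - b) (Q - translate a Q + (translate b P - P))) := by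
  rw [commutatorElement_def, mul_inv_eq_iff_eq_mul, mul_inv_eq_iff_eq_mul, skew_mul, skew_mul,
    skew_mul]
  congr 1
  · ring
  · funext i
    simp only [translate_apply, Pi.add_apply, Pi.sub_apply]
    rw [show i + a + b + (-a - b) = i by ring]
    ring

theorem commutator_skews_le (n : ℕ) : ⁅skews (n + 1), skews (n + 1)⁆ ≤ shears n := by
  rw [Subgroup.commutator_le]
  rintro _ ⟨a, P, hP, rfl⟩ _ ⟨b, Q, hQ, rfl⟩
  refine ⟨_, ?_, commutator_skew a b P Q⟩
  rw [bwdDiff_pow_translate, map_add, map_sub, map_sub, bwdDiff_pow_translate_of_succ hP,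
    bwdDiff_pow_translate_of_succ hQ, sub_self, sub_self, add_zero, map_zero]

theorem commutator_shears_skews_le (n m : ℕ) : ⁅shears (n + 1), skews m⁆ ≤ shears n := by
  rw [Subgroup.commutator_le]
  rintro _ ⟨P, hP, rfl⟩ _ ⟨b, Q, hQ, rfl⟩
  refine ⟨_, ?_, commutator_skew 0 b P Q⟩
  have h0 : translate 0 Q = Q := by funext i; rw [translate_apply, add_zero]
  rw [bwdDiff_pow_translate, map_add, map_sub, map_sub, bwdDiff_pow_translate_of_succ hP, h0,
    sub_self, sub_self, add_zero, map_zero]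

theorem shears_zero : shears 0 = ⊥ := by
  rw [eq_bot_iff]
  rintro _ ⟨P, hP, rfl⟩
  rw [pow_zero, Module.End.one_apply] at hP
  rw [hP, skew_zero_zero]
  exact Subgroup.mem_bot.2 rfl

theorem commutator_shears_eq_bot (n : ℕ) : ⁅shears n, shears n⁆ = ⊥ := by
  rw [eq_bot_iff, Subgroup.commutator_le]
  rintro _ ⟨P, -, rfl⟩ _ ⟨Q, -, rfl⟩
  rw [commutator_skew, Subgroup.mem_bot, ← skew_zero_zero]
  congr 1
  funext i
  simp [translate_apply]

/-- The first commutator already kills the shift component and one degree; each later one costs one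
more degree. -/
theorem lowerCentralSeries_skews_le (n m : ℕ) (hm : m ≤ n) :
    (skews (n + 1)).lowerCentralSeries (m + 1) ≤ shears (n - m) := by
  induction m with
  | zero => simpa using commutator_skews_le n
  | succ m ih =>
    rw [Subgroup.lowerCentralSeries_succ]
    refine (Subgroup.commutator_mono (ih (by omega)) le_rfl).trans ?_
    rw [show n - m = n - (m + 1) + 1 by omega]
    exact commutator_shears_skews_le _ _

theorem risingBinom_zero (i : ℤ) : risingBinom 0 i = 1 := by simp [risingBinom]

theorem risingBinom_succ_sub (k : ℕ) (i : ℤ) :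
    risingBinom (k + 1) i - risingBinom (k + 1) (i - 1) = risingBinom k i := by
  have h0 : ((k + 1)! : ℤ) ≠ 0 := by exact_mod_cast Nat.factorial_ne_zero _
  apply mul_left_cancel₀ h0
  have h2 : ((k + 1)! : ℤ) = (k + 1) * k ! := by push_cast [Nat.factorial_succ]; ring
  rw [mul_sub, factorial_mul_risingBinom, factorial_mul_risingBinom, h2, mul_assoc,
    factorial_mul_risingBinom, Finset.prod_range_succ, Finset.prod_range_succ']
  have h3 : ∏ m ∈ Finset.range k, (i - 1 + ((m + 1 : ℕ) : ℤ)) = ∏ m ∈ Finset.range k, (i + m) :=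
    Finset.prod_congr rfl fun m _ => by push_cast; ring
  rw [h3]
  push_cast
  ring

theorem bwdDiff_risingBinom_succ (k : ℕ) : bwdDiff (risingBinom (k + 1)) = risingBinom k :=
  funext fun i => risingBinom_succ_sub k i

theorem bwdDiff_pow_risingBinom {k n : ℕ} (h : k < n) : (bwdDiff ^ n) (risingBinom k) = 0 := by
  induction k generalizing n with
  | zero =>
    obtain ⟨n, rfl⟩ := Nat.exists_eq_succ_of_ne_zero h.ne'
    have : bwdDiff (risingBinom 0) = 0 := by
      funext i; simp [bwdDiff_apply, risingBinom_zero]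
    rw [pow_succ, Module.End.mul_apply, this, map_zero]
  | succ k ih =>
    obtain ⟨n, rfl⟩ := Nat.exists_eq_succ_of_ne_zero (Nat.ne_of_gt (Nat.zero_lt_of_lt h))
    rw [pow_succ, Module.End.mul_apply, bwdDiff_risingBinom_succ, ih (by omega)]

/-- The group generated by `(i, t) ↦ (i + 1, t)` and `(i, t) ↦ (i, t + r_k(i))` for `k < d`. -/
def modelGroup (d : ℕ) : Subgroup ((ℤ ×ₗ ℝ) ≃o (ℤ ×ₗ ℝ)) :=
  Subgroup.closure (insert (skew 1 0) (range fun k : Fin d => skew 0 (risingBinom k)))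

theorem modelGroup_le_skews (d : ℕ) : modelGroup d ≤ skews d := by
  rw [modelGroup, Subgroup.closure_le, insert_subset_iff]
  refine ⟨⟨1, 0, map_zero _, rfl⟩, ?_⟩
  rintro _ ⟨k, rfl⟩
  exact ⟨0, _, bwdDiff_pow_risingBinom k.2, rfl⟩

theorem modelGroup_isMetabelian (n : ℕ) : IsMetabelian (modelGroup (n + 1)) := by
  rw [isMetabelian_iff, eq_bot_iff, ← commutator_shears_eq_bot n]
  have h := (Subgroup.commutator_mono (modelGroup_le_skews (n + 1))
    (modelGroup_le_skews (n + 1))).trans (commutator_skews_le n)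
  exact Subgroup.commutator_mono h h

/-- Bracketing with the shift descends from `r_n` one index at a time, so after `n` steps the
nontrivial translation `r_0 = 1` is still present. This bounds the class from below. -/
theorem skew_risingBinom_mem_lowerCentralSeries (n k : ℕ) (hk : k ≤ n) :
    skew 0 (risingBinom (n - k)) ∈ (modelGroup (n + 1)).lowerCentralSeries k := by
  induction k with
  | zero =>
    exact Subgroup.subset_closure (mem_insert_of_mem _ ⟨Fin.last n, rfl⟩)
  | succ k ih =>
    have h1 : skew 1 0 ∈ modelGroup (n + 1) := Subgroup.subset_closure (mem_insert _ _)
    have h2 := Subgroup.commutator_mem_commutator (ih (by omega)) h1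
    rw [commutator_skew] at h2
    -- The commutator with the shift is the backward difference, which lowers the index of the
    -- rising binomial by one.
    have h3 : translate (-0 - 1) (0 - translate 0 0 + (translate 1 (risingBinom (n - k)) -
        risingBinom (n - k))) = risingBinom (n - (k + 1)) := by
      funext i
      rw [← risingBinom_succ_sub, show n - (k + 1) + 1 = n - k by omega]
      simp [translate_apply, sub_eq_add_neg]
    rwa [h3] at h2

theorem modelGroup_nilpotent (n : ℕ) :
    (modelGroup (n + 1)).lowerCentralSeries (n + 1) = ⊥ ∧
      (modelGroup (n + 1)).lowerCentralSeries n ≠ ⊥ := by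
  constructor
  · rw [eq_bot_iff, ← shears_zero]
    refine (Subgroup.lowerCentralSeries_mono (n + 1) (modelGroup_le_skews (n + 1))).trans ?_
    simpa using lowerCentralSeries_skews_le n n le_rfl
  · intro h
    have h1 := skew_risingBinom_mem_lowerCentralSeries n n le_rfl
    rw [h, Subgroup.mem_bot, ← skew_zero_zero] at h1
    have h2 := congrFun (skew_zero_injective h1) 0
    simp [risingBinom_zero] at h2

end Skew

/-! ### Gluing `C^1` pieces along the integers -/

section Glue

/-- The function on `ℝ` given by `c n` on `[n, n + 1)`, in the coordinate `t - n`. -/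
def glue (c : ℤ → ℝ → ℝ) (t : ℝ) : ℝ := c ⌊t⌋ (t - ⌊t⌋)

theorem glue_eq {c : ℤ → ℝ → ℝ} (hc : ∀ n, c n 1 = c (n + 1) 0) {n : ℤ} {t : ℝ}
    (ht : t ∈ Icc (n : ℝ) (n + 1)) : glue c t = c n (t - n) := by
  rcases ht.2.lt_or_eq with h | rfl
  · rw [glue, Int.floor_eq_iff.2 ⟨ht.1, h⟩]
  · have h1 : ⌊(n : ℝ) + 1⌋ = n + 1 := by simp
    rw [glue, h1]
    simp [hc]

theorem hasDerivAt_glue {c c' : ℤ → ℝ → ℝ} (hc : ∀ n, c n 1 = c (n + 1) 0)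
    (hc' : ∀ n, c' n 1 = c' (n + 1) 0) (hd : ∀ n s, HasDerivAt (c n) (c' n s) s) (t : ℝ) :
    HasDerivAt (glue c) (glue c' t) t := by
  have key : ∀ (n : ℤ), t ∈ Icc (n : ℝ) (n + 1) →
      HasDerivWithinAt (glue c) (glue c' t) (Icc (n : ℝ) (n + 1)) t := by
    intro n hn
    rw [glue_eq hc' hn]
    refine HasDerivWithinAt.congr (f := fun x => c n (x - n)) ?_ (fun x hx => glue_eq hc hx)
      (glue_eq hc hn)
    exact ((hd n (t - n)).comp_sub_const t n).hasDerivWithinAt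
  have h1 : HasDerivWithinAt (glue c) (glue c' t) (Ici t) t := by
    refine (key ⌊t⌋ ⟨Int.floor_le t, (Int.lt_floor_add_one t).le⟩).mono_of_mem_nhdsWithin ?_
    refine Filter.mem_of_superset (Icc_mem_nhdsGE (Int.lt_floor_add_one t)) ?_
    exact Icc_subset_Icc_left (Int.floor_le t)
  have h2 : HasDerivWithinAt (glue c) (glue c' t) (Iic t) t := by
    have ha : ((⌈t⌉ - 1 : ℤ) : ℝ) < t := by
      have := Int.ceil_lt_add_one t
      push_cast; linarith
    have hb : t ≤ ((⌈t⌉ - 1 : ℤ) : ℝ) + 1 := by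
      have := Int.le_ceil t
      push_cast; linarith
    refine (key (⌈t⌉ - 1) ⟨ha.le, hb⟩).mono_of_mem_nhdsWithin ?_
    exact Filter.mem_of_superset (Icc_mem_nhdsLE ha) (Icc_subset_Icc_right hb)
  have h3 := h2.union h1
  rwa [Iic_union_Ici, hasDerivWithinAt_univ] at h3

end Glue

/-! ### A `C^1` density with prescribed integrals over unit intervals -/

section Interpolation

/-- The weight of a neighbouring value in the interpolation of a sequence by a density. -/
def weight (s : ℝ) : ℝ := (1 - s) ^ 2 * (1 - 4 * s) / 2

/-- The derivative of `weight`. -/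
def weightDeriv (s : ℝ) : ℝ := -3 * (1 - s) * (1 - 2 * s)

/-- The primitive of `weight`. -/
def weightPrim (s : ℝ) : ℝ := s * (1 - s) ^ 3 / 2

theorem hasDerivAt_weight (s : ℝ) : HasDerivAt weight (weightDeriv s) s := by
  have h1 : HasDerivAt (fun x : ℝ => 1 - x) (-1) s := by
    simpa using (hasDerivAt_id s).const_sub 1
  have h2 : HasDerivAt (fun x : ℝ => 1 - 4 * x) (-4) s := by
    simpa using ((hasDerivAt_id s).const_mul 4).const_sub 1
  refine (((h1.pow 2).mul h2).div_const 2).congr_deriv ?_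
  simp [weightDeriv]
  ring

theorem hasDerivAt_weightPrim (s : ℝ) : HasDerivAt weightPrim (weight s) s := by
  have h1 : HasDerivAt (fun x : ℝ => 1 - x) (-1) s := by
    simpa using (hasDerivAt_id s).const_sub 1
  refine (((hasDerivAt_id s).mul (h1.pow 3)).div_const 2).congr_deriv ?_
  simp [weight]
  ring

theorem abs_weight_le {s : ℝ} (hs : s ∈ Icc (0 : ℝ) 1) : |weight s| ≤ 1 / 2 := by
  obtain ⟨h0, h1⟩ := hs
  have h2 : 0 ≤ s * (1 - s) := mul_nonneg h0 (by linarith)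
  rw [weight, abs_le]
  constructor
  · nlinarith [mul_nonneg h2 (sq_nonneg (1 - 2 * s)), sq_nonneg (1 - 2 * s)]
  · nlinarith [mul_nonneg h0 (sq_nonneg (1 - s)), mul_nonneg h0 h0, h2]

/-- The difference of the two sides is `(1 - s)(1 - 2s)²/2`. The bound is sharp enough for
positivity of the density when neighbouring values differ by a factor up to `3`. -/
theorem neg_le_weight {s : ℝ} (hs : s ∈ Icc (0 : ℝ) 1) : -(s * (1 - s) / 2) ≤ weight s := by
  have h : weight s + s * (1 - s) / 2 = (1 - s) * (1 - 2 * s) ^ 2 / 2 := by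
    rw [weight]; ring
  have h1 : 0 ≤ (1 - s) * (1 - 2 * s) ^ 2 / 2 := by
    have := mul_nonneg (sub_nonneg.2 hs.2) (sq_nonneg (1 - 2 * s))
    linarith
  linarith

theorem abs_weightDeriv_le {s : ℝ} (hs : s ∈ Icc (0 : ℝ) 1) : |weightDeriv s| ≤ 3 := by
  obtain ⟨h0, h1⟩ := hs
  rw [weightDeriv, abs_le]
  constructor <;> nlinarith [mul_nonneg h0 (sub_nonneg.2 h1)]

theorem one_sub_mem_Icc {s : ℝ} (hs : s ∈ Icc (0 : ℝ) 1) : 1 - s ∈ Icc (0 : ℝ) 1 :=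
  ⟨by linarith [hs.2], by linarith [hs.1]⟩

/-- A `C^1` density on `ℝ` whose integral over each `[n, n + 1]` is `v n`. -/
def density (v : ℤ → ℝ) : ℝ → ℝ :=
  glue fun n s => v n + (v (n - 1) - v n) * weight s + (v (n + 1) - v n) * weight (1 - s)

/-- The derivative of `density`. -/
def densityDeriv (v : ℤ → ℝ) : ℝ → ℝ :=
  glue fun n s => (v (n - 1) - v n) * weightDeriv s - (v (n + 1) - v n) * weightDeriv (1 - s)

/-- The primitive of `density v` with prescribed values `b n` at the integers. -/
def densityPrim (b v : ℤ → ℝ) : ℝ → ℝ :=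
  glue fun n s => b n +
    (v n * s + (v (n - 1) - v n) * weightPrim s - (v (n + 1) - v n) * weightPrim (1 - s))

theorem density_eq_floor (v : ℤ → ℝ) (t : ℝ) : density v t = v ⌊t⌋ +
    (v (⌊t⌋ - 1) - v ⌊t⌋) * weight (t - ⌊t⌋) + (v (⌊t⌋ + 1) - v ⌊t⌋) * weight (1 - (t - ⌊t⌋)) :=
  rfl

theorem densityDeriv_eq_floor (v : ℤ → ℝ) (t : ℝ) : densityDeriv v t =
    (v (⌊t⌋ - 1) - v ⌊t⌋) * weightDeriv (t - ⌊t⌋) -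
      (v (⌊t⌋ + 1) - v ⌊t⌋) * weightDeriv (1 - (t - ⌊t⌋)) :=
  rfl

/-- The weight has value `1/2` and slope `-3` at `0`, and vanishes to second order at `1`. So at the
integer `n` both adjacent pieces have value `(v (n-1) + v n)/2` and slope `3 (v n - v (n-1))`. -/
theorem hasDerivAt_density (v : ℤ → ℝ) (t : ℝ) :
    HasDerivAt (density v) (densityDeriv v t) t := by
  refine hasDerivAt_glue (fun n => ?_) (fun n => ?_) (fun n s => ?_) t
  · rw [add_sub_cancel_right]
    norm_num [weight]
    ring
  · rw [add_sub_cancel_right]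
    norm_num [weightDeriv]
    ring
  · have h1 : HasDerivAt (fun x : ℝ => weight (1 - x)) (-weightDeriv (1 - s)) s := by
      simpa using (hasDerivAt_weight (1 - s)).comp_const_sub 1 s
    refine ((((hasDerivAt_weight s).const_mul _).const_add _).add (h1.const_mul _)).congr_deriv ?_
    ring

/-- `weightPrim` vanishes at `0` and `1`, so the corrections integrate to zero and the integral over
`[n, n + 1]` is exactly `v n`. -/
theorem hasDerivAt_densityPrim {b v : ℤ → ℝ} (hb : ∀ n, b (n + 1) = b n + v n) (t : ℝ) :
    HasDerivAt (densityPrim b v) (density v t) t := by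
  refine hasDerivAt_glue (fun n => ?_) (fun n => ?_) (fun n s => ?_) t
  · rw [hb]
    norm_num [weightPrim]
  · rw [add_sub_cancel_right]
    norm_num [weight]
    ring
  · have h1 : HasDerivAt (fun x : ℝ => weightPrim (1 - x)) (-weight (1 - s)) s := by
      simpa using (hasDerivAt_weightPrim (1 - s)).comp_const_sub 1 s
    refine (((((hasDerivAt_id s).const_mul _).add ((hasDerivAt_weightPrim s).const_mul _)).sub
      (h1.const_mul _)).const_add _).congr_deriv ?_
    ring

theorem densityPrim_intCast (b v : ℤ → ℝ) (n : ℤ) : densityPrim b v n = b n := by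
  simp [densityPrim, glue, weightPrim]

theorem density_sub (v w : ℤ → ℝ) (t : ℝ) : density (v - w) t = density v t - density w t := by
  simp only [density_eq_floor, Pi.sub_apply]
  ring

theorem densityDeriv_sub (v w : ℤ → ℝ) (t : ℝ) :
    densityDeriv (v - w) t = densityDeriv v t - densityDeriv w t := by
  simp only [densityDeriv_eq_floor, Pi.sub_apply]
  ring

theorem fract_mem (t : ℝ) : t - ⌊t⌋ ∈ Icc (0 : ℝ) 1 :=
  ⟨sub_nonneg.2 (Int.floor_le t), by linarith [(Int.lt_floor_add_one t)]⟩

theorem abs_density_le {v : ℤ → ℝ} {t B : ℝ} (h : ∀ n : ℤ, |n - t| ≤ 2 → |v n| ≤ B) :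
    |density v t| ≤ 3 * B := by
  have hf := Int.floor_le t
  have hf' := Int.lt_floor_add_one t
  have h0 := abs_le.1 (h ⌊t⌋ (abs_le.2 ⟨by linarith, by linarith⟩))
  have h1 := abs_le.1 (h (⌊t⌋ - 1) (abs_le.2 ⟨by push_cast; linarith, by push_cast; linarith⟩))
  have h2 := abs_le.1 (h (⌊t⌋ + 1) (abs_le.2 ⟨by push_cast; linarith, by push_cast; linarith⟩))
  have w1 := abs_weight_le (fract_mem t)
  have w2 := abs_weight_le (one_sub_mem_Icc (fract_mem t))
  have hB : 0 ≤ B := by linarith [h0.1, h0.2]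
  have e1 : |v (⌊t⌋ - 1) - v ⌊t⌋| ≤ 2 * B := abs_le.2 ⟨by linarith, by linarith⟩
  have e2 : |v (⌊t⌋ + 1) - v ⌊t⌋| ≤ 2 * B := abs_le.2 ⟨by linarith, by linarith⟩
  rw [density_eq_floor]
  refine (abs_add_three _ _ _).trans ?_
  rw [abs_mul, abs_mul]
  have := mul_le_mul e1 w1 (abs_nonneg _) (by linarith)
  have := mul_le_mul e2 w2 (abs_nonneg _) (by linarith)
  have := abs_le.2 h0
  linarith

/-- Only differences of consecutive values enter, so the derivative gains whatever decay these
differences have over the values. -/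
theorem abs_densityDeriv_le {v : ℤ → ℝ} {t B : ℝ}
    (h : ∀ n : ℤ, |n - t| ≤ 2 → |v (n + 1) - v n| ≤ B) : |densityDeriv v t| ≤ 6 * B := by
  have hf := Int.floor_le t
  have hf' := Int.lt_floor_add_one t
  have h0 := h ⌊t⌋ (abs_le.2 ⟨by linarith, by linarith⟩)
  have h1 := h (⌊t⌋ - 1) (abs_le.2 ⟨by push_cast; linarith, by push_cast; linarith⟩)
  rw [sub_add_cancel, abs_sub_comm] at h1
  have w1 := abs_weightDeriv_le (fract_mem t)
  have w2 := abs_weightDeriv_le (one_sub_mem_Icc (fract_mem t))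
  have hB : 0 ≤ B := (abs_nonneg _).trans h0
  rw [densityDeriv_eq_floor]
  refine (abs_sub _ _).trans ?_
  rw [abs_mul, abs_mul]
  have := mul_le_mul h1 w1 (abs_nonneg _) hB
  have := mul_le_mul h0 w2 (abs_nonneg _) hB
  linarith

theorem half_le_density {v : ℤ → ℝ} {t : ℝ} (h0 : ∀ n, 0 ≤ v n) (h1 : ∀ n, v (n - 1) ≤ 3 * v n)
    (h2 : ∀ n, v (n + 1) ≤ 3 * v n) : v ⌊t⌋ / 2 ≤ density v t := by
  have hs := fract_mem t
  have w1 := neg_le_weight hs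
  have w2 := neg_le_weight (one_sub_mem_Icc hs)
  rw [density_eq_floor]
  set s := t - ⌊t⌋
  set n := ⌊t⌋
  have hx : 0 ≤ s * (1 - s) := mul_nonneg hs.1 (sub_nonneg.2 hs.2)
  -- After regrouping, the two neighbours contribute at least `-3 v n · s(1 - s)` in total, which
  -- the term `3 s(1 - s) v n` absorbs, leaving `v n / 2`.
  have e : v n + (v (n - 1) - v n) * weight s + (v (n + 1) - v n) * weight (1 - s) =
      v n * (1 / 2 + 3 * (s * (1 - s))) + v (n - 1) * weight s + v (n + 1) * weight (1 - s) := by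
    simp only [weight]; ring
  rw [e]
  have i1 := mul_le_mul_of_nonneg_left w1 (h0 (n - 1))
  have i2 := mul_le_mul_of_nonneg_left w2 (h0 (n + 1))
  have i3 := mul_le_mul_of_nonneg_right (h1 n) hx
  have i4 := mul_le_mul_of_nonneg_right (h2 n) hx
  nlinarith

end Interpolation

/-! ### Charts of the rows and the embedding of `ℤ ×ₗ ℝ` in `[0,1]` -/

/-- A positive summable family of lengths of total mass one, in which the lengths of adjacent
intervals of a row are comparable. -/
structure IsSubdivision (v : ℤ ×ₗ ℤ → ℝ) : Prop where
  pos : ∀ n, 0 < v n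
  hasSum : HasSum v 1
  pred_le : ∀ i j : ℤ, v (toLex (i, j - 1)) ≤ 3 * v (toLex (i, j))
  succ_le : ∀ i j : ℤ, v (toLex (i, j + 1)) ≤ 3 * v (toLex (i, j))

section Subdivision

variable {v : ℤ ×ₗ ℤ → ℝ}

/-- The total length of the intervals with index in `A`. -/
def mass (v : ℤ ×ₗ ℤ → ℝ) (A : Set (ℤ ×ₗ ℤ)) : ℝ := ∑' m, A.indicator v m

/-- The left endpoint of the interval with index `n`. -/
def leftEnd (v : ℤ ×ₗ ℤ → ℝ) (n : ℤ ×ₗ ℤ) : ℝ := mass v (Iio n)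

theorem IsSubdivision.summable (h : IsSubdivision v) (A : Set (ℤ ×ₗ ℤ)) :
    Summable (A.indicator v) := h.hasSum.summable.indicator A

theorem IsSubdivision.mass_univ (h : IsSubdivision v) : mass v univ = 1 := by
  rw [mass, indicator_univ, h.hasSum.tsum_eq]

theorem IsSubdivision.mass_union (h : IsSubdivision v) {A B : Set (ℤ ×ₗ ℤ)} (hAB : Disjoint A B) :
    mass v (A ∪ B) = mass v A + mass v B := by
  rw [mass, indicator_union_of_disjoint hAB]
  exact (h.summable A).tsum_add (h.summable B)

theorem mass_singleton (n : ℤ ×ₗ ℤ) : mass v {n} = v n := by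
  rw [mass, tsum_eq_single n (fun m hm => indicator_of_notMem (by simpa using hm) _),
    indicator_of_mem (mem_singleton n)]

theorem IsSubdivision.mass_mono (h : IsSubdivision v) {A B : Set (ℤ ×ₗ ℤ)} (hAB : A ⊆ B) :
    mass v A ≤ mass v B :=
  (h.summable A).tsum_le_tsum (indicator_le_indicator_of_subset hAB fun n => (h.pos n).le)
    (h.summable B)

theorem IsSubdivision.mass_nonneg (h : IsSubdivision v) (A : Set (ℤ ×ₗ ℤ)) : 0 ≤ mass v A :=
  tsum_nonneg fun _ => indicator_nonneg (fun n _ => (h.pos n).le) _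

/-- Reduces to finite index sets, which have a largest and a smallest element even when `A` has
none. -/
theorem mass_le_of_finset {A : Set (ℤ ×ₗ ℤ)} {c : ℝ} (hc : 0 ≤ c)
    (hs : ∀ s : Finset (ℤ ×ₗ ℤ), ↑s ⊆ A → ∑ m ∈ s, v m ≤ c) : mass v A ≤ c := by
  classical
  refine tsum_le_of_sum_le' hc fun s => ?_
  have := Finset.sum_indicator_eq_sum_filter s (fun _ => v) (fun _ => A) id
  simp only [id] at this
  rw [this]
  exact hs _ fun m hm => (Finset.mem_filter.1 hm).2

theorem IsSubdivision.sum_le_mass (h : IsSubdivision v) {A : Set (ℤ ×ₗ ℤ)}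
    {s : Finset (ℤ ×ₗ ℤ)} (hs : ↑s ⊆ A) : ∑ m ∈ s, v m ≤ mass v A := by
  rw [← Finset.sum_congr rfl fun m hm => indicator_of_mem (hs hm) v]
  exact (h.summable A).sum_le_tsum s fun m _ => indicator_nonneg (fun n _ => (h.pos n).le) m

theorem IsSubdivision.mass_Iic (h : IsSubdivision v) (n : ℤ ×ₗ ℤ) :
    mass v (Iic n) = leftEnd v n + v n := by
  rw [← Iio_union_right, h.mass_union (by simp), mass_singleton, leftEnd]

theorem IsSubdivision.mass_Ici (h : IsSubdivision v) (n : ℤ ×ₗ ℤ) :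
    mass v (Ici n) = 1 - leftEnd v n := by
  rw [← h.mass_univ, ← Iio_union_Ici (a := n), h.mass_union (by
    rw [← compl_Iio]; exact disjoint_compl_right), leftEnd]
  ring

theorem IsSubdivision.leftEnd_succ (h : IsSubdivision v) (i j : ℤ) :
    leftEnd v (toLex (i, j + 1)) = leftEnd v (toLex (i, j)) + v (toLex (i, j)) := by
  rw [← h.mass_Iic, leftEnd]
  congr 1
  ext m
  induction m using Lex.rec with | _ m
  rcases m with ⟨k, l⟩
  simp [Prod.Lex.lt_iff, Prod.Lex.le_iff]

theorem IsSubdivision.leftEnd_add_le (h : IsSubdivision v) {n m : ℤ ×ₗ ℤ} (hnm : n < m) :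
    leftEnd v n + v n ≤ leftEnd v m := by
  rw [← h.mass_Iic]
  exact h.mass_mono fun k hk => lt_of_le_of_lt hk hnm

theorem IsSubdivision.leftEnd_nonneg (h : IsSubdivision v) (n : ℤ ×ₗ ℤ) : 0 ≤ leftEnd v n :=
  h.mass_nonneg _

theorem IsSubdivision.leftEnd_add_le_one (h : IsSubdivision v) (n : ℤ ×ₗ ℤ) :
    leftEnd v n + v n ≤ 1 := by
  rw [← h.mass_Iic, ← h.mass_univ]
  exact h.mass_mono (subset_univ _)

/-- The `C^1` density in the `i`-th row. -/
def rho (v : ℤ ×ₗ ℤ → ℝ) (i : ℤ) : ℝ → ℝ := density fun j => v (toLex (i, j))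

/-- The derivative of `rho v i`. -/
def rhoDeriv (v : ℤ ×ₗ ℤ → ℝ) (i : ℤ) : ℝ → ℝ := densityDeriv fun j => v (toLex (i, j))

/-- The parametrization of the `i`-th row by `ℝ`, sending `[j, j + 1]` to the interval with
index `(i, j)`. -/
def chart (v : ℤ ×ₗ ℤ → ℝ) (i : ℤ) : ℝ → ℝ :=
  densityPrim (fun j => leftEnd v (toLex (i, j))) fun j => v (toLex (i, j))

theorem hasDerivAt_rho (v : ℤ ×ₗ ℤ → ℝ) (i : ℤ) (t : ℝ) :
    HasDerivAt (rho v i) (rhoDeriv v i t) t := hasDerivAt_density _ t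

theorem continuous_rho (v : ℤ ×ₗ ℤ → ℝ) (i : ℤ) : Continuous (rho v i) :=
  continuous_iff_continuousAt.2 fun t => (hasDerivAt_rho v i t).continuousAt

theorem IsSubdivision.half_le_rho (h : IsSubdivision v) (i : ℤ) (t : ℝ) :
    v (toLex (i, ⌊t⌋)) / 2 ≤ rho v i t :=
  half_le_density (v := fun j => v (toLex (i, j))) (fun _ => (h.pos _).le) (h.pred_le i)
    (h.succ_le i)

theorem IsSubdivision.rho_pos (h : IsSubdivision v) (i : ℤ) (t : ℝ) : 0 < rho v i t :=
  (half_pos (h.pos _)).trans_le (h.half_le_rho i t)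

theorem IsSubdivision.hasDerivAt_chart (h : IsSubdivision v) (i : ℤ) (t : ℝ) :
    HasDerivAt (chart v i) (rho v i t) t :=
  hasDerivAt_densityPrim (b := fun j => leftEnd v (toLex (i, j)))
    (v := fun j => v (toLex (i, j))) (h.leftEnd_succ i) t

theorem IsSubdivision.continuous_chart (h : IsSubdivision v) (i : ℤ) : Continuous (chart v i) :=
  continuous_iff_continuousAt.2 fun t => (h.hasDerivAt_chart i t).continuousAt

theorem chart_intCast (v : ℤ ×ₗ ℤ → ℝ) (i j : ℤ) : chart v i j = leftEnd v (toLex (i, j)) :=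
  densityPrim_intCast _ _ j

theorem IsSubdivision.chart_strictMono (h : IsSubdivision v) (i : ℤ) : StrictMono (chart v i) :=
  strictMono_of_hasDerivAt_pos (h.hasDerivAt_chart i) (h.rho_pos i)

theorem IsSubdivision.leftEnd_le_chart (h : IsSubdivision v) (i : ℤ) (t : ℝ) :
    leftEnd v (toLex (i, ⌊t⌋)) ≤ chart v i t := by
  rw [← chart_intCast]
  exact (h.chart_strictMono i).monotone (Int.floor_le t)

theorem IsSubdivision.chart_lt (h : IsSubdivision v) (i : ℤ) (t : ℝ) :
    chart v i t < leftEnd v (toLex (i, ⌊t⌋)) + v (toLex (i, ⌊t⌋)) := by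
  rw [← h.leftEnd_succ, ← chart_intCast]
  refine (h.chart_strictMono i) ?_
  push_cast
  exact Int.lt_floor_add_one t

theorem IsSubdivision.chart_mem (h : IsSubdivision v) (i : ℤ) (t : ℝ) :
    chart v i t ∈ Ioo (0 : ℝ) 1 :=
  ⟨((h.leftEnd_nonneg _).trans (h.leftEnd_le_chart i (t - 1))).trans_lt
      (h.chart_strictMono i (by linarith)),
    (h.chart_lt i t).trans_le (h.leftEnd_add_le_one _)⟩

theorem IsSubdivision.chart_lt_chart (h : IsSubdivision v) {i k : ℤ} (hik : i < k) (s t : ℝ) :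
    chart v i s < chart v k t :=
  (h.chart_lt i s).trans_le ((h.leftEnd_add_le (Prod.Lex.toLex_lt_toLex.2 (Or.inl hik))).trans
    (h.leftEnd_le_chart k t))

/-- The intervals have total length one. If `(x, y)` missed them all, each would lie left of `x` or
right of `y`, and their total length would be at most `x + (1 - y) < 1`. -/
theorem IsSubdivision.exists_chart_between (h : IsSubdivision v) {x y : ℝ} (hx : 0 ≤ x)
    (hxy : x < y) (hy : y ≤ 1) : ∃ i t, x < chart v i t ∧ chart v i t < y := by
  by_contra! hno
  have key : ∀ n, leftEnd v n + v n ≤ x ∨ y ≤ leftEnd v n := by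
    intro n
    induction n using Lex.rec with | _ n
    rcases n with ⟨i, j⟩
    by_contra! hn
    -- An interval on neither side overlaps `(x, y)` in an open set, where the intermediate value
    -- theorem produces a forbidden chart value.
    have h1 : max x (leftEnd v (toLex (i, j))) <
        min y (leftEnd v (toLex (i, j)) + v (toLex (i, j))) :=
      max_lt (lt_min hxy hn.1) (lt_min hn.2 (by linarith [h.pos (toLex (i, j))]))
    obtain ⟨z, hz1, hz2⟩ := exists_between h1
    rw [max_lt_iff] at hz1
    rw [lt_min_iff] at hz2
    have h2 := intermediate_value_Icc (by simp : (j : ℝ) ≤ ((j + 1 : ℤ) : ℝ))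
      (h.continuous_chart i).continuousOn
    rw [chart_intCast, chart_intCast, h.leftEnd_succ] at h2
    obtain ⟨t, -, ht⟩ := h2 ⟨hz1.2.le, hz2.2.le⟩
    have := hno i t (by rw [ht]; exact hz1.1)
    rw [ht] at this
    exact absurd hz2.1 (not_lt.2 this)
  set L := {n | leftEnd v n + v n ≤ x}
  have hL : mass v L ≤ x := by
    refine mass_le_of_finset hx fun s hs => ?_
    rcases s.eq_empty_or_nonempty with rfl | hne
    · simpa using hx
    · refine (h.sum_le_mass (A := Iic (s.max' hne)) fun m hm => s.le_max' m hm).trans ?_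
      rw [h.mass_Iic]
      exact hs (s.max'_mem hne)
  have hL' : mass v Lᶜ ≤ 1 - y := by
    refine mass_le_of_finset (by linarith) fun s hs => ?_
    rcases s.eq_empty_or_nonempty with rfl | hne
    · simpa using hy
    · refine (h.sum_le_mass (A := Ici (s.min' hne)) fun m hm => s.min'_le m hm).trans ?_
      rw [h.mass_Ici]
      have := (key (s.min' hne)).resolve_left (hs (s.min'_mem hne))
      linarith
  have := h.mass_univ
  rw [← union_compl_self L, h.mass_union disjoint_compl_right] at this
  linarith

/-- The embedding of `ℤ × ℝ` in `[0,1]` given by the parametrizations of the rows. -/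
def embed (v : ℤ ×ₗ ℤ → ℝ) (z : ℤ ×ₗ ℝ) : I :=
  projIcc 0 1 zero_le_one (chart v (ofLex z).1 (ofLex z).2)

theorem IsSubdivision.coe_embed (h : IsSubdivision v) (i : ℤ) (t : ℝ) :
    (embed v (toLex (i, t)) : ℝ) = chart v i t := by
  rw [embed, projIcc_of_mem _ (Ioo_subset_Icc_self (h.chart_mem _ _))]
  rfl

theorem IsSubdivision.embed_strictMono (h : IsSubdivision v) : StrictMono (embed v) := by
  intro z w hzw
  induction z using Lex.rec with | _ z
  induction w using Lex.rec with | _ w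
  rcases z with ⟨i, t⟩
  rcases w with ⟨k, s⟩
  rw [← Subtype.coe_lt_coe, h.coe_embed, h.coe_embed]
  rcases Prod.Lex.lt_iff.1 hzw with h1 | ⟨h1, h2⟩
  · exact h.chart_lt_chart h1 t s
  · dsimp at h1 h2
    rw [h1]
    exact h.chart_strictMono k h2

theorem IsSubdivision.exists_embed_between (h : IsSubdivision v) (x y : I) (hxy : x < y) :
    ∃ z, x < embed v z ∧ embed v z < y := by
  obtain ⟨i, t, h1, h2⟩ := h.exists_chart_between x.2.1 hxy y.2.2
  exact ⟨toLex (i, t), by rwa [← Subtype.coe_lt_coe, h.coe_embed],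
    by rwa [← Subtype.coe_lt_coe, h.coe_embed]⟩

/-- The action on `[0,1]` of the automorphisms of `ℤ × ℝ`. -/
def IsSubdivision.action (h : IsSubdivision v) : ((ℤ ×ₗ ℝ) ≃o (ℤ ×ₗ ℝ)) →* (I ≃o I) :=
  denseExtendHom h.embed_strictMono h.exists_embed_between

theorem IsSubdivision.action_injective (h : IsSubdivision v) : Function.Injective h.action :=
  denseExtendHom_injective _ _

theorem IsSubdivision.action_embed (h : IsSubdivision v) (a : ℤ) (P : ℤ → ℤ) (i : ℤ) (t : ℝ) :
    h.action (skew a P) (embed v (toLex (i, t))) = embed v (toLex (i + a, t + P i)) :=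
  denseExtendHom_apply _ _ _ _

theorem IsSubdivision.action_image_Icc (h : IsSubdivision v) (a : ℤ) (P : ℤ → ℤ) (i j : ℤ) :
    h.action (skew a P) '' Icc (embed v (toLex (i, (j : ℝ)))) (embed v (toLex (i, (j : ℝ) + 1))) =
      Icc (embed v (toLex (i + a, ((j + P i : ℤ) : ℝ))))
        (embed v (toLex (i + a, ((j + P i : ℤ) : ℝ) + 1))) := by
  rw [OrderIso.image_Icc, h.action_embed, h.action_embed]
  push_cast
  rw [add_right_comm]

end Subdivision

/-! ### From Hölder bounds on the rows to `C^{1+α}` regularity on `[0,1]` -/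

section Derivative

variable {v : ℤ ×ₗ ℤ → ℝ} {α M : ℝ} {a : ℤ} {P : ℤ → ℤ}

/-- The derivative of the action of `skew a P`, in the coordinates given by the rows. -/
def rhoRatio (v : ℤ ×ₗ ℤ → ℝ) (a : ℤ) (P : ℤ → ℤ) (i : ℤ) (t : ℝ) : ℝ :=
  rho v (i + a) (t + P i) / rho v i t

/-- The derivative of the action of `skew a P`; it is `1` at the ends of the rows. -/
def actionDeriv (v : ℤ ×ₗ ℤ → ℝ) (a : ℤ) (P : ℤ → ℤ) : ℝ → ℝ :=
  Function.extend (fun z : ℤ × ℝ => chart v z.1 z.2) (fun z => rhoRatio v a P z.1 z.2) fun _ => 1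

theorem IsSubdivision.chart_injective (h : IsSubdivision v) :
    Function.Injective fun z : ℤ × ℝ => chart v z.1 z.2 := by
  rintro ⟨i, t⟩ ⟨k, s⟩ (hz : chart v i t = chart v k s)
  rcases lt_trichotomy i k with hik | rfl | hik
  · exact absurd hz (h.chart_lt_chart hik t s).ne
  · rw [(h.chart_strictMono i).injective hz]
  · exact absurd hz (h.chart_lt_chart hik s t).ne'

theorem IsSubdivision.actionDeriv_chart (h : IsSubdivision v) (i : ℤ) (t : ℝ) :
    actionDeriv v a P (chart v i t) = rhoRatio v a P i t :=
  h.chart_injective.extend_apply _ _ (i, t)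

theorem actionDeriv_of_forall_ne {x : ℝ} (hx : ∀ i t, chart v i t ≠ x) :
    actionDeriv v a P x = 1 :=
  Function.extend_apply' _ _ _ fun ⟨z, hz⟩ => hx z.1 z.2 hz

/-- A point outside the `i`-th row lies on one side of it. -/
theorem IsSubdivision.forall_lt_or_forall_gt (h : IsSubdivision v) {i : ℤ} {x : ℝ}
    (hx : ∀ t, chart v i t ≠ x) : (∀ t, chart v i t < x) ∨ ∀ t, x < chart v i t := by
  by_contra! hno
  obtain ⟨⟨t, ht⟩, s, hs⟩ := hno
  obtain ⟨r, hr⟩ := mem_range_of_exists_le_of_exists_ge (h.continuous_chart i) ⟨s, hs⟩ ⟨t, ht⟩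
  exact hx r hr

/-- Let `s` run to the end of the row on the side of `x`: the ratio tends to `1`, while `chart v i
s` stays between `chart v i t` and `x`. -/
theorem IsSubdivision.abs_rhoRatio_sub_one_le (h : IsSubdivision v) (hα : 0 < α) (hM : 0 ≤ M)
    {i : ℤ} (hloc : ∀ s t, |rhoRatio v a P i s - rhoRatio v a P i t| ≤
      M * |chart v i s - chart v i t| ^ α)
    (htop : Tendsto (rhoRatio v a P i) atTop (𝓝 1))
    (hbot : Tendsto (rhoRatio v a P i) atBot (𝓝 1)) {x : ℝ} (hx : ∀ t, chart v i t ≠ x) (t : ℝ) :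
    |rhoRatio v a P i t - 1| ≤ M * |chart v i t - x| ^ α := by
  have hmono := (h.chart_strictMono i).monotone
  rcases h.forall_lt_or_forall_gt hx with hlt | hgt
  · refine le_of_tendsto ((tendsto_const_nhds.sub htop).abs) ?_
    filter_upwards [eventually_ge_atTop t] with s hs
    refine (hloc t s).trans (mul_le_mul_of_nonneg_left ?_ hM)
    refine Real.rpow_le_rpow (abs_nonneg _) ?_ hα.le
    rw [abs_of_nonpos (sub_nonpos.2 (hmono hs)), abs_of_neg (sub_neg.2 (hlt t))]
    linarith [hlt s]
  · refine le_of_tendsto ((tendsto_const_nhds.sub hbot).abs) ?_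
    filter_upwards [eventually_le_atBot t] with s hs
    refine (hloc t s).trans (mul_le_mul_of_nonneg_left ?_ hM)
    refine Real.rpow_le_rpow (abs_nonneg _) ?_ hα.le
    rw [abs_of_nonneg (sub_nonneg.2 (hmono hs)), abs_of_pos (sub_pos.2 (hgt t))]
    linarith [hgt s]

/-- Points in different rows are compared through the value `1`; each half costs `M |x - y|^α`,
whence the factor `2`. -/
theorem IsSubdivision.actionDeriv_holder (h : IsSubdivision v) (hα : 0 < α) (hM : 0 ≤ M)
    (hloc : ∀ i s t, |rhoRatio v a P i s - rhoRatio v a P i t| ≤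
      M * |chart v i s - chart v i t| ^ α)
    (htop : ∀ i, Tendsto (rhoRatio v a P i) atTop (𝓝 1))
    (hbot : ∀ i, Tendsto (rhoRatio v a P i) atBot (𝓝 1)) (x y : ℝ) :
    |actionDeriv v a P x - actionDeriv v a P y| ≤ 2 * M * |x - y| ^ α := by
  have hone : ∀ i t x, (∀ s, chart v i s ≠ x) →
      |actionDeriv v a P (chart v i t) - 1| ≤ M * |chart v i t - x| ^ α := fun i t x hx => by
    rw [h.actionDeriv_chart]
    exact h.abs_rhoRatio_sub_one_le hα hM (hloc i) (htop i) (hbot i) hx t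
  have hpos : ∀ x y : ℝ, 0 ≤ M * |x - y| ^ α := fun x y =>
    mul_nonneg hM (Real.rpow_nonneg (abs_nonneg _) _)
  by_cases hx : ∃ i t, chart v i t = x
  · obtain ⟨i, t, rfl⟩ := hx
    by_cases hy : ∃ k s, chart v k s = y
    · obtain ⟨k, s, rfl⟩ := hy
      rcases eq_or_ne i k with rfl | hik
      · have := hloc i t s
        rw [← h.actionDeriv_chart, ← h.actionDeriv_chart] at this
        linarith [hpos (chart v i t) (chart v i s)]
      · have h1 := hone i t (chart v k s) fun r hr =>
          hik (congrArg Prod.fst (h.chart_injective (a₁ := (i, r)) (a₂ := (k, s)) hr))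
        have h2 := hone k s (chart v i t) fun r hr =>
          hik (congrArg Prod.fst (h.chart_injective (a₁ := (k, r)) (a₂ := (i, t)) hr)).symm
        rw [abs_sub_comm (chart v k s)] at h2
        have h3 := abs_sub_le (actionDeriv v a P (chart v i t)) 1 (actionDeriv v a P (chart v k s))
        rw [abs_sub_comm 1] at h3
        linarith
    · push Not at hy
      rw [actionDeriv_of_forall_ne hy]
      linarith [hone i t y (hy i), hpos (chart v i t) y]
  · push Not at hx
    rw [actionDeriv_of_forall_ne hx]
    by_cases hy : ∃ k s, chart v k s = y
    · obtain ⟨k, s, rfl⟩ := hy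
      have := hone k s x (hx k)
      rw [abs_sub_comm, abs_sub_comm x]
      linarith [hpos (chart v k s) x]
    · push Not at hy
      rw [actionDeriv_of_forall_ne hy, sub_self, abs_zero]
      linarith [hpos x y]

theorem continuous_of_holder {f : ℝ → ℝ} (hα : 0 < α)
    (hf : ∀ x y, |f x - f y| ≤ M * |x - y| ^ α) : Continuous f := by
  refine continuous_iff_continuousAt.2 fun y => tendsto_iff_dist_tendsto_zero.2 ?_
  refine squeeze_zero (fun _ => dist_nonneg) (fun x => hf x y) ?_
  have h1 : Continuous fun x : ℝ => M * |x - y| ^ α :=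
    continuous_const.mul ((continuous_id.sub continuous_const).abs.rpow_const fun _ => Or.inr hα.le)
  simpa [Real.zero_rpow hα.ne'] using h1.tendsto y

theorem IsSubdivision.hasStrictDerivAt_chart (h : IsSubdivision v) (i : ℤ) (t : ℝ) :
    HasStrictDerivAt (chart v i) (rho v i t) t :=
  hasStrictDerivAt_of_hasDerivAt_of_continuousAt (Eventually.of_forall (h.hasDerivAt_chart i))
    (continuous_rho v i).continuousAt

theorem IsSubdivision.toReal_action_chart (h : IsSubdivision v) (i : ℤ) (t : ℝ) :
    toReal (h.action (skew a P)) (chart v i t) = chart v (i + a) (t + P i) := by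
  rw [← h.coe_embed, toReal, projIcc_val, h.action_embed, h.coe_embed]

/-- Near a point of row `i` the map is the chart of row `i + a`, translated, composed with a local
inverse of the chart of row `i`. -/
theorem IsSubdivision.hasDerivAt_toReal_action (h : IsSubdivision v) (i : ℤ) (t : ℝ) :
    HasDerivAt (toReal (h.action (skew a P))) (rhoRatio v a P i t) (chart v i t) := by
  have h1 := h.hasStrictDerivAt_chart i t
  have hne := (h.rho_pos i t).ne'
  have h2 : HasDerivAt (h1.localInverse _ _ _ hne) (rho v i t)⁻¹ (chart v i t) :=
    (h1.to_localInverse hne).hasDerivAt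
  have h3 : h1.localInverse _ _ _ hne (chart v i t) = t :=
    HasStrictFDerivAt.localInverse_apply_image
      (f' := ContinuousLinearEquiv.unitsEquivAut ℝ (Units.mk0 (rho v i t) hne)) h1
  have h4 : ∀ᶠ y in 𝓝 (chart v i t), chart v i (h1.localInverse _ _ _ hne y) = y :=
    HasStrictFDerivAt.eventually_right_inverse
      (f' := ContinuousLinearEquiv.unitsEquivAut ℝ (Units.mk0 (rho v i t) hne)) h1
  have h5 : HasDerivAt (fun s => chart v (i + a) (s + P i)) (rho v (i + a) (t + P i)) t :=
    (h.hasDerivAt_chart (i + a) (t + P i)).comp_add_const t _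
  rw [← h3] at h5
  have h6 := h5.comp (chart v i t) h2
  rw [h3] at h6
  refine (h6.congr_of_eventuallyEq ?_).congr_deriv (div_eq_mul_inv _ _).symm
  filter_upwards [h4] with y hy
  rw [Function.comp_apply, ← h.toReal_action_chart, hy]

/-- A point outside the rows lies just above a last row `i` and below row `i + 1`; by density of the
rows each such gap is at most one point. -/
theorem IsSubdivision.countable_compl_range_chart (h : IsSubdivision v) :
    (Ioo (0 : ℝ) 1 \ {x | ∃ i t, chart v i t = x}).Countable := by
  refine Countable.mono (s₂ := ⋃ i : ℤ, {x | x ∈ Ioo (0 : ℝ) 1 ∧ (∀ t, chart v i t < x) ∧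
    ∀ t, x < chart v (i + 1) t}) ?_ ?_
  · rintro x ⟨hx, hne⟩
    have hne' : ∀ i t, chart v i t ≠ x := fun i t hit => hne ⟨i, t, hit⟩
    have hex : ∃ i, chart v i 0 < x := by
      obtain ⟨i, t, -, hi⟩ := h.exists_chart_between le_rfl hx.1 hx.2.le
      exact ⟨i - 1, (h.chart_lt_chart (by omega) _ _).trans hi⟩
    have hbd : ∃ b : ℤ, ∀ i, chart v i 0 < x → i ≤ b := by
      obtain ⟨b, t, hb, -⟩ := h.exists_chart_between hx.1.le hx.2 le_rfl
      refine ⟨b, fun i hi => not_lt.1 fun hbi => ?_⟩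
      exact lt_asymm (hi.trans hb) (h.chart_lt_chart hbi _ _)
    obtain ⟨i, hi, hmax⟩ := Int.exists_greatest_of_bdd hbd hex
    refine mem_iUnion.2 ⟨i, hx, ?_, ?_⟩
    · exact (h.forall_lt_or_forall_gt (hne' i)).resolve_right fun hh => lt_asymm hi (hh 0)
    · refine (h.forall_lt_or_forall_gt (hne' (i + 1))).resolve_left fun hh => ?_
      have := hmax _ (hh 0)
      omega
  · refine countable_iUnion fun i => Set.Subsingleton.countable ?_
    have key : ∀ x y : ℝ, x ∈ Ioo (0 : ℝ) 1 → y ∈ Ioo (0 : ℝ) 1 → (∀ t, chart v i t < x) →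
        (∀ t, y < chart v (i + 1) t) → ¬ x < y := by
      intro x y hx hy h1 h2 hxy
      obtain ⟨k, t, hk1, hk2⟩ := h.exists_chart_between hx.1.le hxy hy.2.le
      rcases lt_trichotomy k i with hki | rfl | hki
      · exact lt_asymm (hk1.trans (h.chart_lt_chart hki t 0)) (h1 0)
      · exact lt_asymm hk1 (h1 t)
      · rcases (Int.add_one_le_iff.2 hki).eq_or_lt with rfl | hki'
        · exact lt_asymm hk2 (h2 t)
        · exact lt_asymm ((h.chart_lt_chart hki' 0 t).trans hk2) (h2 0)
    rintro x ⟨hx, hx1, hx2⟩ y ⟨hy, hy1, hy2⟩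
    exact le_antisymm (not_lt.1 (key y x hy hx hy1 hx2)) (not_lt.1 (key x y hx hy hx1 hy2))

theorem continuous_toReal (F : I ≃o I) : Continuous (toReal F) :=
  continuous_subtype_val.comp (F.continuous.comp continuous_projIcc)

/-- The fundamental theorem of calculus tolerates a countable exceptional set, so `f` is the
integral of the continuous `D`. This avoids differentiating by hand at the ends of rows. -/
theorem isC1Holder_of_hasDerivAt_off_countable {f : I → I} (hα : 0 < α) {D : ℝ → ℝ} {s : Set ℝ}
    (hD : ∀ x y, |D x - D y| ≤ M * |x - y| ^ α) (hf : Continuous (toReal f)) (hs : s.Countable)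
    (hd : ∀ x ∈ Ioo (0 : ℝ) 1 \ s, HasDerivAt (toReal f) (D x) x) : IsC1Holder α f := by
  have hDc : Continuous D := continuous_of_holder hα hD
  set G : ℝ → ℝ := fun x => toReal f 0 + ∫ u in (0 : ℝ)..x, D u
  have hG : ∀ x, HasDerivAt G (D x) x := fun x =>
    ((hDc.integral_hasStrictDerivAt 0 x).hasDerivAt).const_add _
  have hEq : EqOn (toReal f) G (Icc 0 1) := by
    intro x hx
    have := MeasureTheory.integral_eq_of_hasDerivAt_off_countable (toReal f) D (a := 0) (b := x) hs
      hf.continuousOn (fun y hy => hd y ⟨?_, hy.2⟩) (hDc.intervalIntegrable _ _)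
    · simp [G, this]
    · have h1 := hy.1
      rw [min_eq_left hx.1, max_eq_right hx.1] at h1
      exact ⟨h1.1, h1.2.trans_le hx.2⟩
  have hder : ∀ x ∈ Icc (0 : ℝ) 1, derivWithin (toReal f) (Icc 0 1) x = D x := fun x hx => by
    rw [derivWithin_congr hEq (hEq hx)]
    exact (hG x).hasDerivWithinAt.derivWithin (uniqueDiffOn_Icc zero_lt_one x hx)
  refine ⟨?_, M, fun x hx y hy => by rw [hder x hx, hder y hy]; exact hD x y⟩
  refine ContDiffOn.congr (ContDiff.contDiffOn ?_) hEq
  refine contDiff_one_iff_deriv.2 ⟨fun x => (hG x).differentiableAt, ?_⟩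
  rwa [show deriv G = D from funext fun x => (hG x).deriv]

theorem IsSubdivision.isC1Holder_action (h : IsSubdivision v) (hα : 0 < α) (hM : 0 ≤ M)
    (hloc : ∀ i s t, |rhoRatio v a P i s - rhoRatio v a P i t| ≤
      M * |chart v i s - chart v i t| ^ α)
    (htop : ∀ i, Tendsto (rhoRatio v a P i) atTop (𝓝 1))
    (hbot : ∀ i, Tendsto (rhoRatio v a P i) atBot (𝓝 1)) :
    IsC1Holder α (h.action (skew a P)) := by
  refine isC1Holder_of_hasDerivAt_off_countable hα
    (h.actionDeriv_holder hα hM hloc htop hbot) (continuous_toReal _)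
    h.countable_compl_range_chart fun x hx => ?_
  obtain ⟨i, t, rfl⟩ : ∃ i t, chart v i t = x := by
    by_contra hno
    exact hx.2 ⟨hx.1, hno⟩
  rw [h.actionDeriv_chart]
  exact h.hasDerivAt_toReal_action i t

end Derivative

/-! ### The Hölder estimate on one row -/

section RowEstimate

theorem rpow_half_neg_le {τ a : ℝ} (hτ : 0 < τ) (ha : a ≤ 2) : (τ / 2) ^ (-a) ≤ 4 * τ ^ (-a) := by
  rw [Real.div_rpow hτ.le zero_le_two, div_eq_mul_inv, ← Real.rpow_neg zero_le_two, neg_neg,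
    mul_comm]
  refine mul_le_mul_of_nonneg_right ?_ (Real.rpow_nonneg hτ.le _)
  calc (2 : ℝ) ^ a ≤ 2 ^ (2 : ℝ) := Real.rpow_le_rpow_of_exponent_le (by norm_num) ha
    _ = 4 := by norm_num

theorem half_le_of_abs_sub_le {T s t r : ℝ} (hst : |s - t| ≤ (T + |t|) / 2)
    (hr : r ∈ uIcc s t) : (T + |t|) / 2 ≤ T + |r| ∧ T + |r| ≤ 2 * (T + |t|) := by
  have h1 : |r - t| ≤ |s - t| := by
    rcases le_total s t with h | h
    · rw [uIcc_of_le h] at hr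
      rw [abs_of_nonpos (by linarith [hr.2]), abs_of_nonpos (by linarith)]
      linarith [hr.1]
    · rw [uIcc_of_ge h] at hr
      rw [abs_of_nonneg (by linarith [hr.1]), abs_of_nonneg (by linarith)]
      linarith [hr.2]
  have h2 : |t| - |r| ≤ |r - t| := by rw [abs_sub_comm]; exact abs_sub_abs_le_abs_sub t r
  have h3 : |r| - |t| ≤ |r - t| := abs_sub_abs_le_abs_sub r t
  constructor <;> linarith [abs_nonneg t]

variable {T α q a b K C : ℝ} {u u' c ρ : ℝ → ℝ}

/-- On the window `|s - t| ≤ τ/2` the weights are comparable to those at `τ = T + |t|`. Combine the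
decay bound, raised to `1 - α`, with the mean value bound, raised to `α`; `hab` compares the
resulting exponents of `τ`. -/
theorem abs_sub_le_of_interpolation (hT : 1 ≤ T) (hα₀ : 0 < α) (hα₁ : α < 1) (ha₀ : 0 ≤ a)
    (ha : a ≤ 2) (hb : b ≤ 2) (hb₀ : 0 ≤ b) (hab : q * α ≤ a * (1 - α) + b * α) (hK : 0 ≤ K)
    (hu : ∀ t, |u t| ≤ K * (T + |t|) ^ (-a)) (hd : ∀ t, HasDerivAt u (u' t) t)
    (hu' : ∀ t, |u' t| ≤ K * (T + |t|) ^ (-b)) {s t : ℝ} (hst : |s - t| ≤ (T + |t|) / 2) :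
    |u s - u t| ≤ 8 * K * (|s - t| * (T + |t|) ^ (-q)) ^ α := by
  set τ := T + |t| with hτdef
  have hτ1 : 1 ≤ τ := by linarith [abs_nonneg t]
  have hτ0 : 0 < τ := by linarith
  have hbound : ∀ e : ℝ, 0 ≤ e → e ≤ 2 → ∀ r ∈ uIcc s t, (T + |r|) ^ (-e) ≤ 4 * τ ^ (-e) := by
    intro e he he2 r hr
    refine le_trans ?_ (rpow_half_neg_le hτ0 he2)
    exact Real.rpow_le_rpow_of_nonpos (half_pos hτ0)
      (half_le_of_abs_sub_le hst hr).1 (by linarith)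
  have h1 : |u s - u t| ≤ 8 * K * τ ^ (-a) := by
    have e1 := (hu s).trans (mul_le_mul_of_nonneg_left (hbound a ha₀ ha s left_mem_uIcc) hK)
    have e2 := (hu t).trans (mul_le_mul_of_nonneg_left (hbound a ha₀ ha t right_mem_uIcc) hK)
    calc |u s - u t| ≤ |u s| + |u t| := abs_sub _ _
      _ ≤ K * (4 * τ ^ (-a)) + K * (4 * τ ^ (-a)) := add_le_add e1 e2
      _ = _ := by ring
  have h2 : |u s - u t| ≤ 8 * K * τ ^ (-b) * |s - t| := by
    have := (convex_uIcc s t).norm_image_sub_le_of_norm_hasDerivWithin_le (f := u) (f' := u')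
      (C := 4 * K * τ ^ (-b)) (fun r _ => (hd r).hasDerivWithinAt) (fun r hr => by
        rw [Real.norm_eq_abs]
        refine (hu' r).trans ?_
        have := mul_le_mul_of_nonneg_left (hbound b hb₀ hb r hr) hK
        linarith) right_mem_uIcc left_mem_uIcc
    rw [Real.norm_eq_abs, Real.norm_eq_abs] at this
    refine this.trans (mul_le_mul_of_nonneg_right ?_ (abs_nonneg _))
    have := mul_nonneg hK (Real.rpow_nonneg hτ0.le (-b))
    linarith
  have hp : ∀ e : ℝ, 0 ≤ τ ^ e := fun e => Real.rpow_nonneg hτ0.le e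
  have h3 : |u s - u t| = |u s - u t| ^ (1 - α) * |u s - u t| ^ α := by
    rw [← Real.rpow_add' (abs_nonneg _) (by simp), sub_add_cancel, Real.rpow_one]
  rw [h3]
  calc |u s - u t| ^ (1 - α) * |u s - u t| ^ α
      ≤ (8 * K * τ ^ (-a)) ^ (1 - α) * (8 * K * τ ^ (-b) * |s - t|) ^ α := by
        refine mul_le_mul (Real.rpow_le_rpow (abs_nonneg _) h1 (by linarith))
          (Real.rpow_le_rpow (abs_nonneg _) h2 hα₀.le) (Real.rpow_nonneg (abs_nonneg _) _)
          (Real.rpow_nonneg (mul_nonneg (by linarith) (hp _)) _)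
    _ = ((8 * K) ^ (1 - α) * (8 * K) ^ α) * (τ ^ (-a * (1 - α)) * τ ^ (-b * α)) * |s - t| ^ α := by
        rw [Real.mul_rpow (by linarith) (hp _), Real.mul_rpow (mul_nonneg (by linarith) (hp _))
          (abs_nonneg _), Real.mul_rpow (by linarith) (hp _), ← Real.rpow_mul hτ0.le,
          ← Real.rpow_mul hτ0.le]
        ring
    _ = 8 * K * τ ^ (-a * (1 - α) + -b * α) * |s - t| ^ α := by
        rw [← Real.rpow_add' (by linarith) (by simp), sub_add_cancel, Real.rpow_one,
          ← Real.rpow_add hτ0]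
    _ ≤ 8 * K * τ ^ (-q * α) * |s - t| ^ α := by
        refine mul_le_mul_of_nonneg_right (mul_le_mul_of_nonneg_left ?_ (by linarith))
          (Real.rpow_nonneg (abs_nonneg _) _)
        exact Real.rpow_le_rpow_of_exponent_le hτ1 (by linarith)
    _ = 8 * K * (|s - t| * τ ^ (-q)) ^ α := by
        rw [Real.mul_rpow (abs_nonneg _) (hp _), ← Real.rpow_mul hτ0.le]
        ring

/-- On the same window the density is at least a multiple of `τ^(-q)`, so the distance in `[0,1]`
controls `|s - t| τ^(-q)`. -/
theorem abs_sub_le_chart (hT : 1 ≤ T) (hq₀ : 0 ≤ q) (hq : q ≤ 2) (hC : 0 < C)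
    (hc : ∀ t, HasDerivAt c (ρ t) t) (hρ : ∀ t, C⁻¹ * (T + |t|) ^ (-q) ≤ ρ t) {s t : ℝ}
    (hst : |s - t| ≤ (T + |t|) / 2) :
    |s - t| * (T + |t|) ^ (-q) ≤ 4 * C * |c s - c t| := by
  have hτ0 : 0 < T + |t| := by linarith [abs_nonneg t]
  have hlow : ∀ r ∈ uIcc s t, (4 * C)⁻¹ * (T + |t|) ^ (-q) ≤ ρ r := by
    intro r hr
    refine le_trans ?_ (hρ r)
    have h1 := (half_le_of_abs_sub_le hst hr).2
    have h2 : 0 < T + |r| := by linarith [abs_nonneg r]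
    have h3 : ((T + |r|) / 2) ^ (-q) ≤ 4 * (T + |r|) ^ (-q) := rpow_half_neg_le h2 hq
    have h4 : (T + |t|) ^ (-q) ≤ ((T + |r|) / 2) ^ (-q) :=
      Real.rpow_le_rpow_of_nonpos (half_pos h2) (by linarith) (by linarith)
    rw [mul_inv, mul_assoc, mul_left_comm]
    refine mul_le_mul_of_nonneg_left ?_ (inv_nonneg.2 hC.le)
    linarith
  have key : ∀ x y, x ≤ y → uIcc s t = Icc x y →
      (4 * C)⁻¹ * (T + |t|) ^ (-q) * (y - x) ≤ c y - c x := by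
    intro x y hxy hxy'
    refine (convex_Icc x y).mul_sub_le_image_sub_of_le_deriv
      (fun r _ => (hc r).continuousAt.continuousWithinAt)
      (fun r _ => (hc r).differentiableAt.differentiableWithinAt) (fun r hr => ?_) x
      (left_mem_Icc.2 hxy) y (right_mem_Icc.2 hxy) hxy
    rw [(hc r).deriv]
    exact hlow r (hxy' ▸ interior_subset hr)
  have h4 : (4 * C)⁻¹ * (T + |t|) ^ (-q) * |s - t| ≤ |c s - c t| := by
    rcases le_total s t with h | h
    · rw [abs_sub_comm s t, abs_sub_comm (c s), abs_of_nonneg (sub_nonneg.2 h)]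
      exact (key s t h (uIcc_of_le h)).trans (le_abs_self _)
    · rw [abs_of_nonneg (sub_nonneg.2 h)]
      exact (key t s h (uIcc_of_ge h)).trans (le_abs_self _)
  have h5 := mul_le_mul_of_nonneg_left h4 (by linarith : 0 ≤ 4 * C)
  calc |s - t| * (T + |t|) ^ (-q) = 4 * C * ((4 * C)⁻¹ * (T + |t|) ^ (-q) * |s - t|) := by
        field_simp
    _ ≤ _ := h5

/-- By monotonicity `c s` is at least as far from `c t` as the image of the edge of the window,
where the near estimate gives `τ · τ^(-q)`. -/
theorem abs_sub_le_chart_of_far (hT : 1 ≤ T) (hq₀ : 0 ≤ q) (hq : q ≤ 2) (hC : 0 < C)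
    (hc : ∀ t, HasDerivAt c (ρ t) t) (hρ : ∀ t, C⁻¹ * (T + |t|) ^ (-q) ≤ ρ t) {s t : ℝ}
    (hst : (T + |t|) / 2 < |s - t|) :
    (T + |t|) ^ (1 - q) ≤ 8 * C * |c s - c t| := by
  have hτ0 : 0 < T + |t| := by linarith [abs_nonneg t]
  have hmono : StrictMono c := strictMono_of_hasDerivAt_pos hc fun r =>
    (mul_pos (inv_pos.2 hC) (Real.rpow_pos_of_pos (by linarith [abs_nonneg r]) _)).trans_le (hρ r)
  have h1 : ∃ r, |r - t| = (T + |t|) / 2 ∧ |c r - c t| ≤ |c s - c t| := by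
    rcases le_total s t with h | h
    · rw [abs_of_nonpos (sub_nonpos.2 h)] at hst
      refine ⟨t - (T + |t|) / 2, ?_, ?_⟩
      · rw [sub_sub_cancel_left, abs_neg, abs_of_pos (half_pos hτ0)]
      · have e1 := hmono.monotone (by linarith : s ≤ t - (T + |t|) / 2)
        have e2 := hmono.monotone (by linarith : t - (T + |t|) / 2 ≤ t)
        rw [abs_of_nonpos (sub_nonpos.2 e2), abs_of_nonpos (sub_nonpos.2 (e1.trans e2))]
        linarith
    · rw [abs_of_nonneg (sub_nonneg.2 h)] at hst
      refine ⟨t + (T + |t|) / 2, ?_, ?_⟩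
      · rw [add_sub_cancel_left, abs_of_pos (half_pos hτ0)]
      · have e1 := hmono.monotone (by linarith : t + (T + |t|) / 2 ≤ s)
        have e2 := hmono.monotone (by linarith : t ≤ t + (T + |t|) / 2)
        rw [abs_of_nonneg (sub_nonneg.2 e2), abs_of_nonneg (sub_nonneg.2 (e2.trans e1))]
        linarith
  obtain ⟨r, hr1, hr2⟩ := h1
  have h2 := abs_sub_le_chart hT hq₀ hq hC hc hρ hr1.le
  rw [hr1] at h2
  have h3 : (T + |t|) ^ (1 - q) = (T + |t|) * (T + |t|) ^ (-q) := by
    rw [sub_eq_add_neg, Real.rpow_add hτ0, Real.rpow_one]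
  have h4 := mul_le_mul_of_nonneg_left hr2 (by linarith : 0 ≤ 4 * C)
  linarith

/-- A function on a row with polynomially decaying values and derivative is Hölder continuous
with respect to the coordinate of the interval. -/
theorem row_holder (hT : 1 ≤ T) (hα₀ : 0 < α) (hα₁ : α < 1) (hq₁ : 1 ≤ q) (hq : q ≤ 2)
    (ha₀ : α * (q - 1) ≤ a) (ha : a ≤ 2) (hb₀ : 0 ≤ b) (hb : b ≤ 2)
    (hab : q * α ≤ a * (1 - α) + b * α) (hK : 0 ≤ K) (hC : 0 < C)
    (hu : ∀ t, |u t| ≤ K * (T + |t|) ^ (-a)) (hd : ∀ t, HasDerivAt u (u' t) t)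
    (hu' : ∀ t, |u' t| ≤ K * (T + |t|) ^ (-b)) (hc : ∀ t, HasDerivAt c (ρ t) t)
    (hρ : ∀ t, C⁻¹ * (T + |t|) ^ (-q) ≤ ρ t) (s t : ℝ) :
    |u s - u t| ≤ 8 * K * (8 * C) ^ α * |c s - c t| ^ α := by
  have ha₀' : 0 ≤ a := (mul_nonneg hα₀.le (by linarith)).trans ha₀
  have hnear : ∀ s t : ℝ, |s - t| ≤ (T + |t|) / 2 →
      |u s - u t| ≤ 8 * K * (8 * C) ^ α * |c s - c t| ^ α := by
    intro s t hst
    refine (abs_sub_le_of_interpolation hT hα₀ hα₁ ha₀' ha hb hb₀ hab hK hu hd hu' hst).trans ?_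
    rw [mul_assoc (8 * K), ← Real.mul_rpow (by linarith) (abs_nonneg _)]
    refine mul_le_mul_of_nonneg_left (Real.rpow_le_rpow (mul_nonneg (abs_nonneg _)
      (Real.rpow_nonneg (by linarith [abs_nonneg t]) _)) ?_ hα₀.le) (by linarith)
    refine (abs_sub_le_chart hT (by linarith) hq hC hc hρ hst).trans ?_
    exact mul_le_mul_of_nonneg_right (by linarith) (abs_nonneg _)
  -- Away from the window decay alone suffices: `a ≥ α(q-1)` gives `τ^(-a) ≤ (τ^(1-q))^α`.
  have hfar : ∀ s t : ℝ, (T + |t|) / 2 < |s - t| →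
      |u t| ≤ K * (8 * C) ^ α * |c s - c t| ^ α := by
    intro s t hst
    have hτ1 : 1 ≤ T + |t| := by linarith [abs_nonneg t]
    refine (hu t).trans ?_
    rw [mul_assoc K, ← Real.mul_rpow (by linarith) (abs_nonneg _)]
    refine mul_le_mul_of_nonneg_left ?_ hK
    calc (T + |t|) ^ (-a) ≤ (T + |t|) ^ ((1 - q) * α) :=
          Real.rpow_le_rpow_of_exponent_le hτ1 (by linarith)
      _ = ((T + |t|) ^ (1 - q)) ^ α := Real.rpow_mul (by linarith) _ _
      _ ≤ _ := Real.rpow_le_rpow (Real.rpow_nonneg (by linarith) _)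
          (abs_sub_le_chart_of_far hT (by linarith) hq hC hc hρ hst) hα₀.le
  rcases le_or_gt (|s - t|) ((T + |t|) / 2) with h1 | h1
  · exact hnear s t h1
  rcases le_or_gt (|t - s|) ((T + |s|) / 2) with h2 | h2
  · rw [abs_sub_comm, abs_sub_comm (c s)]
    exact hnear t s h2
  -- When neither point lies in the window of the other, `u s` and `u t` are bounded separately.
  · have e1 := hfar s t h1
    have e2 := hfar t s h2
    rw [abs_sub_comm (c t)] at e2
    have e3 : 0 ≤ K * (8 * C) ^ α * |c s - c t| ^ α := by positivity
    refine (abs_sub _ _).trans ?_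
    linarith

theorem tendsto_zero_of_abs_le {l : Filter ℝ} (hl : Tendsto (fun t : ℝ => |t|) l atTop)
    (ha : 0 < a) (hu : ∀ t, |u t| ≤ K * (T + |t|) ^ (-a)) : Tendsto u l (𝓝 0) := by
  refine squeeze_zero_norm hu ?_
  have := ((tendsto_rpow_neg_atTop ha).comp (tendsto_atTop_add_const_left _ T hl)).const_mul K
  simpa using this

end RowEstimate

/-! ### Elementary inequalities for powers -/

section Powers

variable {q : ℝ}

theorem rpow_sub_rpow_le {x y : ℝ} (hq : 1 ≤ q) (hy : 0 ≤ y) (hyx : y ≤ x) :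
    x ^ q - y ^ q ≤ q * x ^ (q - 1) * (x - y) := by
  rcases (hy.trans hyx).eq_or_lt with rfl | hx
  · rw [le_antisymm hyx hy]; simp
  · have h1 := one_add_mul_self_le_rpow_one_add (s := y / x - 1)
      (by linarith [div_nonneg hy hx.le]) hq
    rw [add_sub_cancel, Real.div_rpow hy hx.le, le_div_iff₀ (Real.rpow_pos_of_pos hx q)] at h1
    have h2 : x ^ q = x ^ (q - 1) * x := by
      rw [← Real.rpow_add_one hx.ne', sub_add_cancel]
    have h3 : (1 + q * (y / x - 1)) * x ^ q = x ^ q - q * x ^ (q - 1) * (x - y) := by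
      rw [h2]; field_simp; ring
    linarith

theorem abs_rpow_sub_rpow_le {x y m : ℝ} (hq : 1 ≤ q) (hx : 0 ≤ x) (hy : 0 ≤ y) (hxm : x ≤ m)
    (hym : y ≤ m) : |x ^ q - y ^ q| ≤ q * m ^ (q - 1) * |x - y| := by
  wlog hyx : y ≤ x generalizing x y
  · rw [abs_sub_comm, abs_sub_comm x]
    exact this hy hx hym hxm (le_of_not_ge hyx)
  rw [abs_of_nonneg (sub_nonneg.2 hyx), abs_of_nonneg
    (sub_nonneg.2 (Real.rpow_le_rpow hy hyx (by linarith)))]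
  refine (rpow_sub_rpow_le hq hy hyx).trans ?_
  refine mul_le_mul_of_nonneg_right (mul_le_mul_of_nonneg_left ?_ (by linarith)) (by linarith)
  exact Real.rpow_le_rpow hx hxm (by linarith)

theorem add_one_rpow_le {x : ℝ} (hx : 0 ≤ x) (hq₁ : 1 ≤ q) (hq : q ≤ 2) :
    (x + 1) ^ q ≤ 2 * (x ^ q + 1) := by
  have h1 := (convexOn_rpow hq₁).2 (x := x) (y := 1) hx (by simp : (1 : ℝ) ∈ Ici 0)
    (by norm_num : (0 : ℝ) ≤ 1 / 2) (by norm_num : (0 : ℝ) ≤ 1 / 2) (by norm_num)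
  simp only [smul_eq_mul, Real.one_rpow] at h1
  have h2 : (2 : ℝ) ^ q ≤ 4 := by
    calc (2 : ℝ) ^ q ≤ 2 ^ (2 : ℝ) := Real.rpow_le_rpow_of_exponent_le (by norm_num) hq
      _ = 4 := by norm_num
  have h3 : (x + 1) ^ q = 2 ^ q * (1 / 2 * x + 1 / 2 * 1) ^ q := by
    rw [← Real.mul_rpow (by norm_num) (by linarith)]
    congr 1; ring
  rw [h3]
  have h4 : 0 ≤ (1 / 2 * x + 1 / 2 * 1) ^ q := Real.rpow_nonneg (by linarith) _
  nlinarith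

theorem add_one_pow_le {x : ℝ} (hx : 0 ≤ x) (N : ℕ) : (1 + x) ^ N ≤ 2 ^ N * (1 + x ^ N) := by
  have h2 : (0 : ℝ) ≤ 2 ^ N := by positivity
  have h3 : 0 ≤ x ^ N := pow_nonneg hx N
  rcases le_total x 1 with h | h
  · have h1 : (1 + x) ^ N ≤ 2 ^ N := pow_le_pow_left₀ (by linarith) (by linarith) N
    nlinarith
  · have h1 : (1 + x) ^ N ≤ (2 * x) ^ N := pow_le_pow_left₀ (by linarith) (by linarith) N
    rw [mul_pow] at h1
    nlinarith

theorem rpow_add_le_nine_mul {x y z : ℝ} (hx : 0 ≤ x) (hy : 0 ≤ y) (hz : 0 ≤ z) (hq₀ : 0 ≤ q)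
    (hq : q ≤ 2) : (x + y + z) ^ q ≤ 9 * (x ^ q + y ^ q + z ^ q) := by
  have key : ∀ m, 0 ≤ m → x + y + z ≤ 3 * m → (x + y + z) ^ q ≤ 9 * m ^ q := by
    intro m hm h
    refine (Real.rpow_le_rpow (by positivity) h hq₀).trans ?_
    rw [Real.mul_rpow (by norm_num) hm]
    refine mul_le_mul_of_nonneg_right ?_ (Real.rpow_nonneg hm q)
    calc (3 : ℝ) ^ q ≤ 3 ^ (2 : ℝ) := Real.rpow_le_rpow_of_exponent_le (by norm_num) hq
      _ = 9 := by norm_num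
  have px := Real.rpow_nonneg hx q
  have py := Real.rpow_nonneg hy q
  have pz := Real.rpow_nonneg hz q
  rcases le_total x y with h1 | h1 <;> rcases le_total y z with h2 | h2 <;>
    rcases le_total x z with h3 | h3
  all_goals first
    | linarith [key x hx (by linarith)]
    | linarith [key y hy (by linarith)]
    | linarith [key z hz (by linarith)]

end Powers

/-! ### Size, variation and summability of the lengths -/

section Lengths

/-- The reciprocal of `blockLength p q (i, j)`. -/
def invLength (p q : ℝ) (i j : ℤ) : ℝ := |(i : ℝ)| ^ p + |(j : ℝ)| ^ q + 1

theorem blockLength_toLex (p q : ℝ) (i j : ℤ) :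
    blockLength p q (toLex (i, j)) = (invLength p q i j)⁻¹ := one_div _

theorem one_le_invLength (p q : ℝ) (i j : ℤ) : 1 ≤ invLength p q i j := by
  rw [invLength]
  linarith [Real.rpow_nonneg (abs_nonneg (i : ℝ)) p, Real.rpow_nonneg (abs_nonneg (j : ℝ)) q]

theorem blockLength_pos (p q : ℝ) (n : ℤ ×ₗ ℤ) : 0 < blockLength p q n := by
  have := one_le_invLength p q (ofLex n).1 (ofLex n).2
  rw [invLength] at this
  rw [blockLength]
  positivity

/-- The index at which the lengths of the intervals in the `i`-th row start to decay. -/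
def rowWidth (N : ℕ) (i : ℤ) : ℝ := 1 + |(i : ℝ)| ^ N

theorem one_le_rowWidth (N : ℕ) (i : ℤ) : 1 ≤ rowWidth N i := by
  rw [rowWidth]
  linarith [pow_nonneg (abs_nonneg (i : ℝ)) N]

theorem abs_intCast_le_of_abs_sub_le_one {i k : ℤ} (h : |k - i| ≤ 1) :
    |(k : ℝ)| ≤ 1 + |(i : ℝ)| := by
  have h1 : |((k - i : ℤ) : ℝ)| ≤ 1 := by exact_mod_cast h
  push_cast at h1
  linarith [abs_sub_abs_le_abs_sub (k : ℝ) i]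

/-- Makes `τ` comparable between adjacent rows. The radius `3` covers the indices `⌊t⌋ - 1`, `⌊t⌋`,
`⌊t⌋ + 1` used by the density at `t`, plus one more for consecutive differences. -/
theorem rowWidth_add_abs_le (N : ℕ) {i k : ℤ} (hik : |k - i| ≤ 1) {s t : ℝ} (hst : |s - t| ≤ 3) :
    rowWidth N k + |s| ≤ (2 ^ N + 4) * (rowWidth N i + |t|) := by
  have h1 : |(k : ℝ)| ^ N ≤ 2 ^ N * rowWidth N i :=
    (pow_le_pow_left₀ (abs_nonneg _) (abs_intCast_le_of_abs_sub_le_one hik) N).trans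
      (add_one_pow_le (abs_nonneg _) N)
  have h2 : |s| - |t| ≤ |s - t| := abs_sub_abs_le_abs_sub s t
  have h3 := one_le_rowWidth N i
  have h4 : (0 : ℝ) < 2 ^ N := by positivity
  have h5 : 0 ≤ 2 ^ N * |t| := by positivity
  rw [rowWidth]
  nlinarith [abs_nonneg t]

theorem add_one_pow_le_rowWidth (N : ℕ) (i : ℤ) : (1 + |(i : ℝ)|) ^ N ≤ 2 ^ N * rowWidth N i :=
  add_one_pow_le (abs_nonneg _) N

/-- Turns growth in the row index into powers of `τ`: `1 + |i|` is at most `2 τ^(1/N)`. -/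
theorem add_one_rpow_le_rowWidth {N : ℕ} (hN : 1 ≤ N) {e : ℝ} (he : 0 ≤ e) (i : ℤ) {τ : ℝ}
    (hτ : rowWidth N i ≤ τ) : (1 + |(i : ℝ)|) ^ e ≤ 2 ^ e * τ ^ (e / N) := by
  have hN0 : (N : ℝ) ≠ 0 := by positivity
  have h1 : (0 : ℝ) ≤ 1 + |(i : ℝ)| := by positivity
  have h2 : (N : ℝ) * (e / N) = e := by field_simp
  have h3 : (1 + |(i : ℝ)|) ^ e = ((1 + |(i : ℝ)|) ^ N) ^ (e / N) := by
    rw [← Real.rpow_natCast_mul h1, h2]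
  have h4 : (2 : ℝ) ^ e = (2 ^ N) ^ (e / N) := by
    rw [← Real.rpow_natCast_mul zero_le_two, h2]
  have h5 := one_le_rowWidth N i
  rw [h3, h4, ← Real.mul_rpow (by positivity) (by linarith)]
  refine Real.rpow_le_rpow (by positivity) ((add_one_pow_le_rowWidth N i).trans ?_) (by positivity)
  exact mul_le_mul_of_nonneg_left hτ (by positivity)

variable {N : ℕ} {q : ℝ}

theorem abs_rpow_natCast_mul (N : ℕ) (q : ℝ) (i : ℤ) :
    |(i : ℝ)| ^ (N * q) = (|(i : ℝ)| ^ N) ^ q := Real.rpow_natCast_mul (abs_nonneg _) N q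

theorem invLength_le (hq : 0 ≤ q) (i j : ℤ) :
    invLength (N * q) q i j ≤ 3 * (rowWidth N i + |(j : ℝ)|) ^ q := by
  have h0 := pow_nonneg (abs_nonneg (i : ℝ)) N
  have hj := abs_nonneg (j : ℝ)
  rw [invLength, abs_rpow_natCast_mul, rowWidth]
  have h1 : (|(i : ℝ)| ^ N) ^ q ≤ (1 + |(i : ℝ)| ^ N + |(j : ℝ)|) ^ q :=
    Real.rpow_le_rpow h0 (by linarith) hq
  have h2 : |(j : ℝ)| ^ q ≤ (1 + |(i : ℝ)| ^ N + |(j : ℝ)|) ^ q :=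
    Real.rpow_le_rpow hj (by linarith) hq
  have h3 : 1 ≤ (1 + |(i : ℝ)| ^ N + |(j : ℝ)|) ^ q := Real.one_le_rpow (by linarith) hq
  linarith

theorem le_invLength (hq₀ : 0 ≤ q) (hq : q ≤ 2) (i j : ℤ) :
    (rowWidth N i + |(j : ℝ)|) ^ q ≤ 9 * invLength (N * q) q i j := by
  rw [invLength, abs_rpow_natCast_mul, rowWidth]
  have := rpow_add_le_nine_mul zero_le_one (pow_nonneg (abs_nonneg (i : ℝ)) N)
    (abs_nonneg (j : ℝ)) hq₀ hq
  rw [Real.one_rpow] at this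
  linarith

theorem invLength_le_three_mul (p : ℝ) (hq₁ : 1 ≤ q) (hq : q ≤ 2) (i : ℤ) {j k : ℤ}
    (hjk : |k - j| ≤ 1) : invLength p q i k ≤ 3 * invLength p q i j := by
  have h1 : |(k : ℝ)| ^ q ≤ 2 * (|(j : ℝ)| ^ q + 1) := by
    refine le_trans ?_ (add_one_rpow_le (abs_nonneg _) hq₁ hq)
    refine Real.rpow_le_rpow (abs_nonneg _) ?_ (by linarith)
    rw [add_comm]
    exact abs_intCast_le_of_abs_sub_le_one hjk
  rw [invLength, invLength]
  linarith [Real.rpow_nonneg (abs_nonneg (i : ℝ)) p, Real.rpow_nonneg (abs_nonneg (j : ℝ)) q]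

theorem blockLength_le_three_mul (p : ℝ) (hq₁ : 1 ≤ q) (hq : q ≤ 2) (i : ℤ) {j k : ℤ}
    (hjk : |k - j| ≤ 1) :
    blockLength p q (toLex (i, j)) ≤ 3 * blockLength p q (toLex (i, k)) := by
  have h1 := one_le_invLength p q i k
  have h2 := one_le_invLength p q i j
  rw [blockLength_toLex, blockLength_toLex, ← div_eq_mul_inv, inv_le_comm₀ (by linarith)
    (by positivity), inv_div, div_le_iff₀ (by norm_num)]
  linarith [invLength_le_three_mul p hq₁ hq i hjk]

/-- Bounds on the reciprocals of the lengths near the point `t` of the `i`-th row. -/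
theorem exists_invLength_bounds (hN : 1 ≤ N) (hq₁ : 1 ≤ q) (hq : q ≤ 2) :
    ∃ C : ℝ, 1 ≤ C ∧ ∀ i k : ℤ, |k - i| ≤ 1 → ∀ t : ℝ,
      |(|(k : ℝ)| ^ (N * q) - |(i : ℝ)| ^ (N * q))| ≤ C * (1 + |(i : ℝ)|) ^ (N * q - 1) ∧
      ∀ j : ℤ, |j - t| ≤ 3 →
        (rowWidth N i + |t|) ^ q ≤ C * invLength (N * q) q k j ∧
        invLength (N * q) q k j ≤ C * (rowWidth N i + |t|) ^ q ∧
        (|j - t| ≤ 2 → |(|((j + 1 : ℤ) : ℝ)| ^ q - |(j : ℝ)| ^ q)| ≤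
          C * ((rowWidth N i + |t|) ^ q / (rowWidth N i + |t|))) := by
  set K : ℝ := 2 ^ N + 4 with hK
  have hK1 : 1 ≤ K := by
    have : (0 : ℝ) < 2 ^ N := by positivity
    linarith
  have hKq : K ^ q ≤ K ^ 2 := by
    rw [← Real.rpow_natCast]
    exact Real.rpow_le_rpow_of_exponent_le hK1 (by simpa using hq)
  have hN' : (1 : ℝ) ≤ N := by exact_mod_cast hN
  refine ⟨9 * K ^ 2 + N * q, by nlinarith, fun i k hik t => ⟨?_, fun j hj => ?_⟩⟩
  · have h1 : (1 : ℝ) ≤ N * q := by nlinarith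
    refine (abs_rpow_sub_rpow_le h1 (abs_nonneg _) (abs_nonneg _)
      (abs_intCast_le_of_abs_sub_le_one hik) (by linarith : |(i : ℝ)| ≤ 1 + |(i : ℝ)|)).trans ?_
    have h2 : |(|(k : ℝ)| - |(i : ℝ)|)| ≤ 1 := by
      refine (abs_abs_sub_abs_le_abs_sub _ _).trans ?_
      exact_mod_cast hik
    have h3 : 0 ≤ (1 + |(i : ℝ)|) ^ (N * q - 1) := by positivity
    calc N * q * (1 + |(i : ℝ)|) ^ (N * q - 1) * |(|(k : ℝ)| - |(i : ℝ)|)|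
        ≤ N * q * (1 + |(i : ℝ)|) ^ (N * q - 1) * 1 :=
          mul_le_mul_of_nonneg_left h2 (by positivity)
      _ ≤ _ := by
          rw [mul_one]
          exact mul_le_mul_of_nonneg_right (by nlinarith) h3
  · have hT := one_le_rowWidth N i
    have hτ1 : 1 ≤ rowWidth N i + |t| := by linarith [abs_nonneg t]
    set τ := rowWidth N i + |t|
    have hτq : 0 < τ ^ q := Real.rpow_pos_of_pos (by linarith) q
    have hNq : 0 ≤ N * q := by positivity
    have hW := one_le_invLength (N * q) q k j
    refine ⟨?_, ?_, fun hj' => ?_⟩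
    · have h1 : τ ≤ K * (rowWidth N k + |(j : ℝ)|) :=
        rowWidth_add_abs_le N (by rwa [abs_sub_comm]) (by rwa [abs_sub_comm])
      have h2 : 0 ≤ rowWidth N k + |(j : ℝ)| := by
        linarith [one_le_rowWidth N k, abs_nonneg (j : ℝ)]
      calc τ ^ q ≤ (K * (rowWidth N k + |(j : ℝ)|)) ^ q :=
            Real.rpow_le_rpow (by linarith) h1 (by linarith)
        _ = K ^ q * (rowWidth N k + |(j : ℝ)|) ^ q := Real.mul_rpow (by linarith) h2
        _ ≤ K ^ 2 * (9 * invLength (N * q) q k j) := mul_le_mul hKq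
            (le_invLength (by linarith) hq k j) (Real.rpow_nonneg h2 _) (by positivity)
        _ ≤ _ := by nlinarith
    · have h1 : rowWidth N k + |(j : ℝ)| ≤ K * τ := rowWidth_add_abs_le N hik hj
      have h2 : 0 ≤ rowWidth N k + |(j : ℝ)| := by
        linarith [one_le_rowWidth N k, abs_nonneg (j : ℝ)]
      calc invLength (N * q) q k j ≤ 3 * (rowWidth N k + |(j : ℝ)|) ^ q :=
            invLength_le (by linarith) k j
        _ ≤ 3 * (K * τ) ^ q := mul_le_mul_of_nonneg_left
            (Real.rpow_le_rpow h2 h1 (by linarith)) (by norm_num)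
        _ = 3 * (K ^ q * τ ^ q) := by rw [Real.mul_rpow (by linarith) (by linarith)]
        _ ≤ 3 * (K ^ 2 * τ ^ q) := mul_le_mul_of_nonneg_left
            (mul_le_mul_of_nonneg_right hKq hτq.le) (by norm_num)
        _ ≤ _ := by nlinarith [mul_pos (by positivity : (0 : ℝ) < K ^ 2) hτq]
    · have hb : ∀ l : ℤ, |l - t| ≤ 3 → |(l : ℝ)| ≤ K * τ := fun l hl => by
        have := rowWidth_add_abs_le N (i := i) (k := i) (by simp) hl
        linarith
      have hj1 : |((j + 1 : ℤ) : ℝ) - t| ≤ 3 := by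
        have := abs_le.1 hj'
        exact abs_le.2 ⟨by push_cast; linarith, by push_cast; linarith⟩
      refine (abs_rpow_sub_rpow_le hq₁ (abs_nonneg _) (abs_nonneg _) (hb _ hj1)
        (hb _ hj)).trans ?_
      have h2 : |(|((j + 1 : ℤ) : ℝ)| - |(j : ℝ)|)| ≤ 1 := by
        refine (abs_abs_sub_abs_le_abs_sub _ _).trans ?_
        simp
      have h3 : (K * τ) ^ (q - 1) ≤ K * (τ ^ q / τ) := by
        rw [Real.mul_rpow (by linarith) (by linarith), ← Real.rpow_sub_one (by linarith)]
        refine mul_le_mul_of_nonneg_right ?_ (Real.rpow_nonneg (by linarith) _)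
        calc K ^ (q - 1) ≤ K ^ (1 : ℝ) := Real.rpow_le_rpow_of_exponent_le hK1 (by linarith)
          _ = K := Real.rpow_one K
      have h4 : 0 ≤ τ ^ q / τ := div_nonneg hτq.le (by linarith)
      have h5 : 0 ≤ (K * τ) ^ (q - 1) := Real.rpow_nonneg (by nlinarith) _
      calc q * (K * τ) ^ (q - 1) * |(|((j + 1 : ℤ) : ℝ)| - |(j : ℝ)|)|
          ≤ q * (K * τ) ^ (q - 1) * 1 := mul_le_mul_of_nonneg_left h2 (by positivity)
        _ ≤ 2 * (K * (τ ^ q / τ)) := by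
            rw [mul_one]; exact mul_le_mul hq h3 h5 (by norm_num)
        _ ≤ _ := by
            rw [← mul_assoc]
            exact mul_le_mul_of_nonneg_right (by nlinarith) h4

/-- The total of the lengths is finite. -/
theorem summable_blockLength {p q : ℝ} (hp : 0 < p) (hq : 0 < q) (hpq : 1 / p + 1 / q < 1) :
    Summable (blockLength p q) := by
  -- With `1/p < θ < 1 - 1/q`, weighted AM-GM bounds the length by twice `(|i|^p + 1)^(-θ) (|j|^q +
  -- 1)^(-(1-θ))`, a product of two convergent series.
  obtain ⟨θ, h1, h2⟩ := exists_between (by linarith : 1 / p < 1 - 1 / q)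
  have hθ0 : 0 < θ := (by positivity : 0 < 1 / p).trans h1
  have hθ1 : θ < 1 := h2.trans (by linarith [(by positivity : 0 < 1 / q)])
  have hpθ : 1 < p * θ := by rwa [div_lt_iff₀ hp, mul_comm] at h1
  have hqθ : 1 < q * (1 - θ) := by
    have : 1 / q < 1 - θ := by linarith
    rwa [div_lt_iff₀ hq, mul_comm] at this
  have key : ∀ r η : ℝ, 0 < η → 1 < r * η →
      Summable fun i : ℤ => (|(i : ℝ)| ^ r + 1) ^ (-η) := by
    intro r η hη hrη
    refine Summable.of_norm_bounded_eventually (Real.summable_abs_int_rpow hrη) ?_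
    filter_upwards [(Set.finite_singleton (0 : ℤ)).compl_mem_cofinite] with i hi
    have hi0 : 0 < |(i : ℝ)| := by simpa using hi
    have hir : 0 < |(i : ℝ)| ^ r := Real.rpow_pos_of_pos hi0 r
    rw [Real.norm_of_nonneg (by positivity), ← mul_neg, Real.rpow_mul hi0.le]
    exact Real.rpow_le_rpow_of_nonpos hir (by linarith) (by linarith)
  have hs := (key p θ hθ0 hpθ).mul_of_nonneg (key q (1 - θ) (by linarith) hqθ)
    (fun i => by positivity) (fun i => by positivity)
  rw [← (toLex (α := ℤ × ℤ)).summable_iff]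
  refine Summable.of_nonneg_of_le (fun n => (blockLength_pos p q _).le) (fun n => ?_)
    (hs.mul_left 2)
  obtain ⟨i, j⟩ := n
  have hi := Real.rpow_nonneg (abs_nonneg (i : ℝ)) p
  have hj := Real.rpow_nonneg (abs_nonneg (j : ℝ)) q
  rw [Function.comp_apply, blockLength_toLex, invLength]
  dsimp only
  set x := |(i : ℝ)| ^ p
  set y := |(j : ℝ)| ^ q
  have hx1 : 0 < x + 1 := by linarith
  have hy1 : 0 < y + 1 := by linarith
  have h3 := Real.geom_mean_le_arith_mean2_weighted hθ0.le (by linarith : 0 ≤ 1 - θ) hx1.le hy1.le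
    (by ring)
  have h4 : θ * (x + 1) + (1 - θ) * (y + 1) ≤ 2 * (x + y + 1) := by nlinarith
  rw [Real.rpow_neg hx1.le, Real.rpow_neg hy1.le, ← mul_inv]
  have h5 : 0 < (x + 1) ^ θ * (y + 1) ^ (1 - θ) := by positivity
  rw [← div_eq_mul_inv, inv_le_comm₀ (by linarith) (by positivity), inv_div,
    div_le_iff₀ (by norm_num)]
  linarith

end Lengths

/-! ### Bounds on the row densities and their variation between adjacent rows -/

section RowBounds

/-- The lengths of the intervals, normalized to have total mass one. -/
def normLength (p q : ℝ) (n : ℤ ×ₗ ℤ) : ℝ := blockLength p q n / totalLength p q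

theorem totalLength_pos {p q : ℝ} (hs : Summable (blockLength p q)) : 0 < totalLength p q :=
  hs.tsum_pos (fun n => (blockLength_pos p q n).le) (toLex (0, 0)) (blockLength_pos p q _)

theorem isSubdivision_normLength {p q : ℝ} (hs : Summable (blockLength p q)) (hq₁ : 1 ≤ q)
    (hq : q ≤ 2) : IsSubdivision (normLength p q) where
  pos n := div_pos (blockLength_pos p q n) (totalLength_pos hs)
  hasSum := by
    have := hs.hasSum.div_const (totalLength p q)
    rwa [← totalLength, div_self (totalLength_pos hs).ne'] at this
  pred_le i j := by
    rw [normLength, normLength, ← mul_div_assoc]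
    exact div_le_div_of_nonneg_right (blockLength_le_three_mul p hq₁ hq i (by simp))
      (totalLength_pos hs).le
  succ_le i j := by
    rw [normLength, normLength, ← mul_div_assoc]
    exact div_le_div_of_nonneg_right (blockLength_le_three_mul p hq₁ hq i (by simp))
      (totalLength_pos hs).le

theorem abs_inv_sub_inv_le {C X δ w₁ w₂ : ℝ} (hX : 0 < X) (hw₁ : 0 < w₁)
    (hw₂ : 0 < w₂) (h₁ : X ≤ C * w₁) (h₂ : X ≤ C * w₂) (h : |w₁ - w₂| ≤ δ) :
    |w₁⁻¹ - w₂⁻¹| ≤ C ^ 2 * δ / X ^ 2 := by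
  have h3 : X ^ 2 ≤ C ^ 2 * (w₁ * w₂) := by
    have := mul_le_mul h₁ h₂ hX.le (hX.le.trans h₁)
    nlinarith
  have hδ : 0 ≤ δ := (abs_nonneg _).trans h
  rw [inv_sub_inv hw₁.ne' hw₂.ne', abs_div, abs_of_pos (mul_pos hw₁ hw₂), abs_sub_comm,
    div_le_div_iff₀ (mul_pos hw₁ hw₂) (pow_pos hX 2)]
  calc |w₁ - w₂| * X ^ 2 ≤ δ * (C ^ 2 * (w₁ * w₂)) := mul_le_mul h h3 (sq_nonneg X) hδ
    _ = _ := by ring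

/-- The second mixed difference of `(a, b) ↦ (a + b)⁻¹`. -/
theorem abs_mixed_inv_le {C X δ ε a₁ a₂ b₁ b₂ : ℝ} (hX : 0 < X) (hC : 0 ≤ C)
    (p₁₁ : 0 < a₁ + b₁) (p₁₂ : 0 < a₁ + b₂) (p₂₁ : 0 < a₂ + b₁) (p₂₂ : 0 < a₂ + b₂)
    (l₁₁ : X ≤ C * (a₁ + b₁)) (l₁₂ : X ≤ C * (a₁ + b₂)) (l₂₁ : X ≤ C * (a₂ + b₁))
    (l₂₂ : X ≤ C * (a₂ + b₂)) (u₁₁ : a₁ + b₁ ≤ C * X) (u₂₂ : a₂ + b₂ ≤ C * X)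
    (ha : |a₁ - a₂| ≤ δ) (hb : |b₁ - b₂| ≤ ε) :
    |((a₁ + b₁)⁻¹ - (a₂ + b₁)⁻¹) - ((a₁ + b₂)⁻¹ - (a₂ + b₂)⁻¹)| ≤
      2 * C ^ 5 * (δ * ε) / X ^ 3 := by
  -- Exact factorization: both differences come out, leaving one sum over a product of four, of
  -- order `X / X⁴`.
  have e : ((a₁ + b₁)⁻¹ - (a₂ + b₁)⁻¹) - ((a₁ + b₂)⁻¹ - (a₂ + b₂)⁻¹) =
      (a₁ - a₂) * (b₁ - b₂) * ((a₁ + b₁) + (a₂ + b₂)) /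
        ((a₁ + b₁) * (a₁ + b₂) * ((a₂ + b₁) * (a₂ + b₂))) := by
    field_simp
    ring
  have hδ : 0 ≤ δ := (abs_nonneg _).trans ha
  have hε : 0 ≤ ε := (abs_nonneg _).trans hb
  have hprod : 0 < (a₁ + b₁) * (a₁ + b₂) * ((a₂ + b₁) * (a₂ + b₂)) := by positivity
  have h4 : X ^ 4 ≤ C ^ 4 * ((a₁ + b₁) * (a₁ + b₂) * ((a₂ + b₁) * (a₂ + b₂))) := by
    have e1 := mul_le_mul l₁₁ l₁₂ hX.le (hX.le.trans l₁₁)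
    have e2 := mul_le_mul l₂₁ l₂₂ hX.le (hX.le.trans l₂₁)
    have e3 := mul_le_mul e1 e2 (by positivity) ((by positivity : 0 ≤ X * X).trans e1)
    calc X ^ 4 = X * X * (X * X) := by ring
      _ ≤ _ := e3
      _ = _ := by ring
  rw [e, abs_div, abs_of_pos hprod, abs_mul, abs_mul, abs_of_pos (add_pos p₁₁ p₂₂),
    div_le_div_iff₀ hprod (by positivity)]
  have h5 : |a₁ - a₂| * |b₁ - b₂| ≤ δ * ε := mul_le_mul ha hb (abs_nonneg _) hδ
  have h6 : a₁ + b₁ + (a₂ + b₂) ≤ 2 * (C * X) := by linarith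
  calc |a₁ - a₂| * |b₁ - b₂| * (a₁ + b₁ + (a₂ + b₂)) * X ^ 3
      ≤ δ * ε * (2 * (C * X)) * X ^ 3 := by
        refine mul_le_mul_of_nonneg_right (mul_le_mul h5 h6 (by linarith) (by positivity))
          (by positivity)
    _ = 2 * C * (δ * ε) * X ^ 4 := by ring
    _ ≤ 2 * C * (δ * ε) * (C ^ 4 * ((a₁ + b₁) * (a₁ + b₂) * ((a₂ + b₁) * (a₂ + b₂)))) :=
        mul_le_mul_of_nonneg_left h4 (by positivity)
    _ = _ := by ring

/-- Bounds on the densities of the rows. -/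
structure RowBounds (v : ℤ ×ₗ ℤ → ℝ) (N : ℕ) (q C : ℝ) : Prop where
  one_le : 1 ≤ C
  lower : ∀ i t, C⁻¹ * (rowWidth N i + |t|) ^ (-q) ≤ rho v i t
  upper : ∀ i t, |rho v i t| ≤ C * (rowWidth N i + |t|) ^ (-q)
  deriv : ∀ i t, |rhoDeriv v i t| ≤
    C * ((rowWidth N i + |t|) ^ (-q) / (rowWidth N i + |t|))
  diff : ∀ i k, |k - i| ≤ 1 → ∀ t, |rho v k t - rho v i t| ≤
    C * ((1 + |(i : ℝ)|) ^ (N * q - 1) * ((rowWidth N i + |t|) ^ (-q)) ^ 2)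
  derivDiff : ∀ i k, |k - i| ≤ 1 → ∀ t, |rhoDeriv v k t - rhoDeriv v i t| ≤
    C * ((1 + |(i : ℝ)|) ^ (N * q - 1) * ((rowWidth N i + |t|) ^ (-q)) ^ 2 /
      (rowWidth N i + |t|))

theorem RowBounds.of_le {v : ℤ ×ₗ ℤ → ℝ} {N : ℕ} {q c₁ c₂ c₃ c₄ c₅ : ℝ} (hc₁ : 1 ≤ c₁)
    (hc₂ : 0 ≤ c₂) (hc₃ : 0 ≤ c₃) (hc₄ : 0 ≤ c₄) (hc₅ : 0 ≤ c₅)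
    (h₁ : ∀ i t, c₁⁻¹ * (rowWidth N i + |t|) ^ (-q) ≤ rho v i t)
    (h₂ : ∀ i t, |rho v i t| ≤ c₂ * (rowWidth N i + |t|) ^ (-q))
    (h₃ : ∀ i t, |rhoDeriv v i t| ≤
      c₃ * ((rowWidth N i + |t|) ^ (-q) / (rowWidth N i + |t|)))
    (h₄ : ∀ i k, |k - i| ≤ 1 → ∀ t, |rho v k t - rho v i t| ≤
      c₄ * ((1 + |(i : ℝ)|) ^ (N * q - 1) * ((rowWidth N i + |t|) ^ (-q)) ^ 2))
    (h₅ : ∀ i k, |k - i| ≤ 1 → ∀ t, |rhoDeriv v k t - rhoDeriv v i t| ≤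
      c₅ * ((1 + |(i : ℝ)|) ^ (N * q - 1) * ((rowWidth N i + |t|) ^ (-q)) ^ 2 /
        (rowWidth N i + |t|))) :
    RowBounds v N q (c₁ + c₂ + c₃ + c₄ + c₅) := by
  have hτ : ∀ i (t : ℝ), 0 < rowWidth N i + |t| := fun i t => by
    linarith [one_le_rowWidth N i, abs_nonneg t]
  have hY : ∀ i (t : ℝ), 0 < (rowWidth N i + |t|) ^ (-q) := fun i t =>
    Real.rpow_pos_of_pos (hτ i t) _
  refine ⟨by linarith, fun i t => ?_, fun i t => ?_, fun i t => ?_, fun i k hik t => ?_,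
    fun i k hik t => ?_⟩
  · refine le_trans (mul_le_mul_of_nonneg_right ?_ (hY i t).le) (h₁ i t)
    exact inv_anti₀ (by linarith) (by linarith)
  · exact (h₂ i t).trans (mul_le_mul_of_nonneg_right (by linarith) (hY i t).le)
  · exact (h₃ i t).trans (mul_le_mul_of_nonneg_right (by linarith)
      (div_nonneg (hY i t).le (hτ i t).le))
  · exact (h₄ i k hik t).trans (mul_le_mul_of_nonneg_right (by linarith) (by positivity))
  · exact (h₅ i k hik t).trans (mul_le_mul_of_nonneg_right (by linarith)
      (div_nonneg (by positivity) (hτ i t).le))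

/-- Since `density` is linear in the lengths, each bound reduces to finitely many lengths near `t`:
their size, their differences in `j` or in `i`, and their mixed difference. A difference in `j`
gains `τ⁻¹`; a difference in `i` gains `(1 + |i|)^(Nq-1) τ^(-q)`. -/
theorem exists_rowBounds {N : ℕ} {q : ℝ} (hN : 1 ≤ N) (hq₁ : 1 ≤ q) (hq : q ≤ 2)
    (hs : Summable (blockLength (N * q) q)) : ∃ C, RowBounds (normLength (N * q) q) N q C := by
  obtain ⟨C, hC1, hC⟩ := exists_invLength_bounds hN hq₁ hq
  have hsub := isSubdivision_normLength hs hq₁ hq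
  set S := totalLength (N * q) q
  have hS : 0 < S := totalLength_pos hs
  set w := invLength (N * q) q
  have hv : ∀ i j, normLength (N * q) q (toLex (i, j)) = (w i j)⁻¹ / S := fun i j => by
    rw [normLength, blockLength_toLex]
  have hw : ∀ i j, 0 < w i j := fun i j => zero_lt_one.trans_le (one_le_invLength _ _ _ _)
  have hτ : ∀ i (t : ℝ), 0 < rowWidth N i + |t| := fun i t => by
    linarith [one_le_rowWidth N i, abs_nonneg t]
  have hX : ∀ i (t : ℝ), 0 < (rowWidth N i + |t|) ^ q := fun i t =>
    Real.rpow_pos_of_pos (hτ i t) _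
  have hY : ∀ i (t : ℝ), (rowWidth N i + |t|) ^ (-q) = ((rowWidth N i + |t|) ^ q)⁻¹ := fun i t =>
    Real.rpow_neg (hτ i t).le q
  have hself : ∀ i : ℤ, |i - i| ≤ 1 := fun i => by simp
  have hsucc : ∀ (j : ℤ) (t : ℝ), |j - t| ≤ 2 → |((j + 1 : ℤ) : ℝ) - t| ≤ 3 := fun j t h => by
    have := abs_le.1 h
    exact abs_le.2 ⟨by push_cast; linarith, by push_cast; linarith⟩
  have hshift : ∀ i j, w i (j + 1) - w i j = |((j + 1 : ℤ) : ℝ)| ^ q - |(j : ℝ)| ^ q :=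
    fun i j => by simp only [w, invLength]; ring
  have hshift' : ∀ i k j, w k j - w i j = |(k : ℝ)| ^ (N * q) - |(i : ℝ)| ^ (N * q) :=
    fun i k j => by simp only [w, invLength]; ring
  refine ⟨_, RowBounds.of_le (c₁ := 1 + 2 * C * S) (c₂ := 3 * (C / S)) (c₃ := 6 * (C ^ 3 / S))
    (c₄ := 3 * (C ^ 3 / S)) (c₅ := 6 * (2 * C ^ 7 / S)) (by nlinarith) (by positivity)
    (by positivity) (by positivity) (by positivity) (fun i t => ?_) (fun i t => ?_)
    (fun i t => ?_) (fun i k hik t => ?_) (fun i k hik t => ?_)⟩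
  · refine le_trans ?_ (hsub.half_le_rho i t)
    have h1 : |(⌊t⌋ : ℝ) - t| ≤ 3 :=
      abs_le.2 ⟨by linarith [Int.lt_floor_add_one t], by linarith [Int.floor_le t]⟩
    obtain ⟨-, h2, -⟩ := (hC i i (hself i) t).2 ⌊t⌋ h1
    rw [hv, hY, div_div, inv_eq_one_div (w i ⌊t⌋), div_div, ← mul_inv, inv_eq_one_div]
    refine one_div_le_one_div_of_le (mul_pos (hw _ _) (by positivity)) ?_
    have h3 := mul_le_mul_of_nonneg_right h2 (by positivity : 0 ≤ S * 2)
    nlinarith [hX i t]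
  · refine (abs_density_le (B := C / S * (rowWidth N i + |t|) ^ (-q)) fun j hj => ?_).trans
      (by rw [mul_assoc])
    obtain ⟨h2, -, -⟩ := (hC i i (hself i) t).2 j (hj.trans (by norm_num))
    rw [hv, hY, abs_of_pos (div_pos (inv_pos.2 (hw _ _)) hS), div_mul_eq_mul_div]
    refine div_le_div_of_nonneg_right ?_ hS.le
    rw [← div_eq_mul_inv, le_div_iff₀ (hX i t), inv_mul_le_iff₀ (hw _ _), mul_comm]
    exact h2
  · refine (abs_densityDeriv_le (B := C ^ 3 / S * ((rowWidth N i + |t|) ^ (-q) /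
      (rowWidth N i + |t|))) fun j hj => ?_).trans (by rw [mul_assoc])
    obtain ⟨h2, -, h4⟩ := (hC i i (hself i) t).2 j (hj.trans (by norm_num))
    obtain ⟨h2', -, -⟩ := (hC i i (hself i) t).2 (j + 1) (hsucc j t hj)
    have h5 := h4 hj
    rw [← hshift i] at h5
    rw [hv, hv, ← sub_div, abs_div, abs_of_pos hS, hY, div_mul_eq_mul_div]
    refine div_le_div_of_nonneg_right ?_ hS.le
    refine (abs_inv_sub_inv_le (hX i t) (hw _ _) (hw _ _) h2' h2 h5).trans (le_of_eq ?_)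
    have := (hX i t).ne'
    have := (hτ i t).ne'
    field_simp
  · rw [rho, rho, ← density_sub]
    refine (abs_density_le (B := C ^ 3 / S * ((1 + |(i : ℝ)|) ^ (N * q - 1) *
      ((rowWidth N i + |t|) ^ (-q)) ^ 2)) fun j hj => ?_).trans (by rw [mul_assoc])
    obtain ⟨h1, h6⟩ := hC i k hik t
    obtain ⟨h2, -, -⟩ := h6 j (hj.trans (by norm_num))
    obtain ⟨h2', -, -⟩ := (hC i i (hself i) t).2 j (hj.trans (by norm_num))
    rw [← hshift' i k j] at h1
    rw [Pi.sub_apply, hv, hv, ← sub_div, abs_div, abs_of_pos hS, hY, div_mul_eq_mul_div]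
    refine div_le_div_of_nonneg_right ?_ hS.le
    refine (abs_inv_sub_inv_le (hX i t) (hw _ _) (hw _ _) h2 h2' h1).trans (le_of_eq ?_)
    have := (hX i t).ne'
    field_simp
  · rw [rhoDeriv, rhoDeriv, ← densityDeriv_sub]
    refine (abs_densityDeriv_le (B := 2 * C ^ 7 / S * ((1 + |(i : ℝ)|) ^ (N * q - 1) *
      ((rowWidth N i + |t|) ^ (-q)) ^ 2 / (rowWidth N i + |t|))) fun j hj => ?_).trans
      (by rw [mul_assoc])
    obtain ⟨h1, h6⟩ := hC i k hik t
    obtain ⟨h2, u2, h4⟩ := h6 j (hj.trans (by norm_num))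
    obtain ⟨h3, u3, -⟩ := h6 (j + 1) (hsucc j t hj)
    obtain ⟨h2', u2', -⟩ := (hC i i (hself i) t).2 j (hj.trans (by norm_num))
    obtain ⟨h3', u3', -⟩ := (hC i i (hself i) t).2 (j + 1) (hsucc j t hj)
    -- The reciprocal length is a function of the row plus a function of the column, the form
    -- required for the mixed difference.
    have hsplit : ∀ k j, w k j = |(k : ℝ)| ^ (N * q) + (|(j : ℝ)| ^ q + 1) := fun k j => by
      simp only [w, invLength]; ring
    have hp := hw
    simp only [hsplit] at hp
    simp only [Pi.sub_apply, hv]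
    change _ ≤ C * w k j at h2
    change _ ≤ C * w k (j + 1) at h3
    change w k (j + 1) ≤ _ at u3
    change _ ≤ C * w i j at h2'
    change w i j ≤ _ at u2'
    change _ ≤ C * w i (j + 1) at h3'
    rw [hsplit] at h2 h3 u3 h2' u2' h3'
    have h8 := h4 hj
    rw [← add_sub_add_right_eq_sub _ _ 1] at h8
    have h7 := abs_mixed_inv_le (hX i t) (by linarith) (hp k (j + 1)) (hp k j) (hp i (j + 1))
      (hp i j) h3 h2 h3' h2' u3 u2' h1 h8
    rw [← hsplit, ← hsplit, ← hsplit, ← hsplit] at h7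
    rw [← sub_div, ← sub_div, ← sub_div, abs_div, abs_of_pos hS, hY, div_mul_eq_mul_div]
    refine div_le_div_of_nonneg_right (h7.trans (le_of_eq ?_)) hS.le
    have := (hX i t).ne'
    have := (hτ i t).ne'
    field_simp

end RowBounds

/-! ### Regularity of the shift and of the shears -/

section Regularity

variable {v : ℤ ×ₗ ℤ → ℝ} {N : ℕ} {q C α : ℝ}

theorem hasDerivAt_rhoRatio_sub_one (h : IsSubdivision v) (a : ℤ) (P : ℤ → ℤ) (i : ℤ) (t : ℝ) :
    HasDerivAt (fun t => rhoRatio v a P i t - 1)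
      ((rhoDeriv v (i + a) (t + P i) * rho v i t - rho v (i + a) (t + P i) * rhoDeriv v i t) /
        rho v i t ^ 2) t := by
  have h1 : HasDerivAt (fun s => rho v (i + a) (s + P i)) (rhoDeriv v (i + a) (t + P i)) t :=
    (hasDerivAt_rho v (i + a) (t + P i)).comp_add_const t _
  exact (h1.div (hasDerivAt_rho v i t) (h.rho_pos i t).ne').sub_const 1

/-- The action of `skew a P` is `C^{1+α}` if its derivative tends to one polynomially fast. -/
theorem isC1Holder_action_of_decay (h : IsSubdivision v) (hv : RowBounds v N q C)
    (hα₀ : 0 < α) (hα₁ : α < 1) (hq₁ : 1 < q) (hq : q ≤ 2) {a : ℤ} {P : ℤ → ℤ} {x y K : ℝ}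
    (hx₀ : α * (q - 1) ≤ x) (hx : x ≤ 2) (hy₀ : 0 ≤ y) (hy : y ≤ 2)
    (hxy : q * α ≤ x * (1 - α) + y * α) (hK : 0 ≤ K)
    (hu : ∀ i t, |rhoRatio v a P i t - 1| ≤ K * (rowWidth N i + |t|) ^ (-x))
    (hu' : ∀ i t, |(rhoDeriv v (i + a) (t + P i) * rho v i t -
      rho v (i + a) (t + P i) * rhoDeriv v i t) / rho v i t ^ 2| ≤
        K * (rowWidth N i + |t|) ^ (-y)) :
    IsC1Holder α (h.action (skew a P)) := by
  have hC : 0 < C := zero_lt_one.trans_le hv.one_le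
  have hx' : 0 < x := (mul_pos hα₀ (by linarith)).trans_le hx₀
  refine h.isC1Holder_action hα₀ (M := 8 * K * (8 * C) ^ α) (by positivity) (fun i s t => ?_)
    (fun i => ?_) fun i => ?_
  · have := row_holder (one_le_rowWidth N i) hα₀ hα₁ hq₁.le hq hx₀ hx hy₀ hy hxy hK hC (hu i)
      (hasDerivAt_rhoRatio_sub_one h a P i) (hu' i) (h.hasDerivAt_chart i) (hv.lower i) s t
    rwa [sub_sub_sub_cancel_right] at this
  · simpa using (tendsto_zero_of_abs_le tendsto_abs_atTop_atTop hx' (hu i)).add_const 1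
  · simpa using (tendsto_zero_of_abs_le tendsto_abs_atBot_atTop hx' (hu i)).add_const 1

/-- Passing to an adjacent row changes the density by a relative amount `(1 + |i|)^(Nq-1) τ^(-q)`,
at most a multiple of `τ^(-1/N)`; the derivative in `t` gains a further `τ⁻¹`. Allowing `|a| ≤ 1`
covers the inverse. -/
theorem isC1Holder_action_shift (h : IsSubdivision v) (hv : RowBounds v N q C) (hN : 1 ≤ N)
    (hα₀ : 0 < α) (hα₁ : α < 1) (hq₁ : 1 < q) (hq : q ≤ 2) (hqN : α * (q - 1) = 1 / N) {a : ℤ}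
    (ha : |a| ≤ 1) : IsC1Holder α (h.action (skew a 0)) := by
  have hN' : (1 : ℝ) ≤ N := by exact_mod_cast hN
  have hinv : (1 : ℝ) / N ≤ 1 := by rw [div_le_one (by linarith)]; exact hN'
  have hinv₀ : (0 : ℝ) < 1 / N := by positivity
  have hC := hv.one_le
  set E : ℝ := 2 ^ (N * q - 1) with hE
  have hE0 : 0 < E := by positivity
  -- The exponents add up to `(Nq - 1)/N - q = -1/N`.
  have key : ∀ (i : ℤ) (t : ℝ), (1 + |(i : ℝ)|) ^ (N * q - 1) * (rowWidth N i + |t|) ^ (-q) ≤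
      E * (rowWidth N i + |t|) ^ (-(1 / N) : ℝ) := by
    intro i t
    have hτ : 0 < rowWidth N i + |t| := by linarith [one_le_rowWidth N i, abs_nonneg t]
    have h1 := add_one_rpow_le_rowWidth hN (by nlinarith : (0 : ℝ) ≤ N * q - 1) i
      (by linarith [abs_nonneg t] : rowWidth N i ≤ rowWidth N i + |t|)
    refine (mul_le_mul_of_nonneg_right h1 (Real.rpow_nonneg hτ.le _)).trans (le_of_eq ?_)
    rw [mul_assoc, ← Real.rpow_add hτ]
    congr 2
    field_simp
    ring
  have hik : ∀ i : ℤ, |i + a - i| ≤ 1 := fun i => by simpa using ha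
  refine isC1Holder_action_of_decay h hv hα₀ hα₁ hq₁ hq (x := 1 / N) (y := 1 / N + 1)
    (K := 2 * C ^ 4 * E) hqN.le (by linarith) (by linarith) (by linarith) (by nlinarith)
    (by positivity) (fun i t => ?_) fun i t => ?_
  all_goals
    have hτ : 0 < rowWidth N i + |t| := by linarith [one_le_rowWidth N i, abs_nonneg t]
    have hY : 0 < (rowWidth N i + |t|) ^ (-q) := Real.rpow_pos_of_pos hτ _
    have hρ := h.rho_pos i t
    have hlow := hv.lower i t
    have hup := hv.upper i t
    have hder := hv.deriv i t
    have hdiff := hv.diff i (i + a) (hik i) t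
    have hdd := hv.derivDiff i (i + a) (hik i) t
    have hkey := key i t
    have hA : 0 ≤ (1 + |(i : ℝ)|) ^ (N * q - 1) := by positivity
    set A := (1 + |(i : ℝ)|) ^ (N * q - 1)
    set Y := (rowWidth N i + |t|) ^ (-q)
    set Z := (rowWidth N i + |t|) ^ (-(1 / N) : ℝ) with hZ
    set τ := rowWidth N i + |t|
    rw [inv_mul_le_iff₀ (by linarith)] at hlow
  · simp only [rhoRatio, Pi.zero_apply, Int.cast_zero, add_zero]
    rw [div_sub_one hρ.ne', abs_div, abs_of_pos hρ, div_le_iff₀ hρ]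
    have hZ0 : 0 ≤ E * Z := (mul_nonneg hA hY.le).trans hkey
    calc |rho v (i + a) t - rho v i t| ≤ C * (A * Y ^ 2) := hdiff
      _ = C * (A * Y) * Y := by ring
      _ ≤ C * (E * Z) * (C * rho v i t) :=
          mul_le_mul (mul_le_mul_of_nonneg_left hkey (by linarith)) hlow hY.le (by positivity)
      _ = C ^ 2 * (E * Z * rho v i t) := by ring
      _ ≤ (2 * C ^ 4) * (E * Z * rho v i t) := by
          refine mul_le_mul_of_nonneg_right ?_ (by positivity)
          have : C ^ 2 ≤ C ^ 4 := pow_le_pow_right₀ hC (by norm_num)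
          nlinarith [sq_nonneg C]
      _ = _ := by ring
  · simp only [Pi.zero_apply, Int.cast_zero, add_zero]
    rw [abs_div, abs_of_pos (pow_pos hρ 2), div_le_iff₀ (pow_pos hρ 2)]
    have hZ0 : 0 ≤ E * Z := (mul_nonneg hA hY.le).trans hkey
    have hZ' : τ ^ (-(1 / N + 1) : ℝ) = Z / τ := by
      rw [neg_add, ← sub_eq_add_neg, Real.rpow_sub_one hτ.ne']
    rw [hZ']
    have e : rhoDeriv v (i + a) t * rho v i t - rho v (i + a) t * rhoDeriv v i t =
        (rhoDeriv v (i + a) t - rhoDeriv v i t) * rho v i t -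
          (rho v (i + a) t - rho v i t) * rhoDeriv v i t := by ring
    rw [e]
    refine (abs_sub _ _).trans ?_
    rw [abs_mul, abs_mul]
    calc |rhoDeriv v (i + a) t - rhoDeriv v i t| * |rho v i t| +
          |rho v (i + a) t - rho v i t| * |rhoDeriv v i t|
        ≤ C * (A * Y ^ 2 / τ) * (C * Y) + C * (A * Y ^ 2) * (C * (Y / τ)) := by gcongr
      _ = 2 * C ^ 2 * (A * Y) / τ * Y ^ 2 := by ring
      _ ≤ 2 * C ^ 2 * (E * Z) / τ * (C * rho v i t) ^ 2 :=
          mul_le_mul (div_le_div_of_nonneg_right (mul_le_mul_of_nonneg_left hkey (by positivity))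
            hτ.le) (pow_le_pow_left₀ hY.le hlow 2) (by positivity) (by positivity)
      _ = _ := by ring

/-- Translation by `P i = O(τ^(1-y))` changes `ρ` by a relative amount `|P i| / τ = O(τ^(-y))`,
because `ρ'/ρ = O(τ⁻¹)`. For the derivative of the ratio the crude bound `τ⁻¹` is enough. -/
theorem isC1Holder_action_shear (h : IsSubdivision v) (hv : RowBounds v N q C)
    (hα₀ : 0 < α) (hα₁ : α < 1) (hq₁ : 1 < q) (hq : q ≤ 2) {P : ℤ → ℤ} {B y : ℝ} (hB : 0 ≤ B)
    (hP : ∀ i, |(P i : ℝ)| ≤ B * rowWidth N i ^ (1 - y)) (hy₀ : α * (q - 1) ≤ y) (hy₁ : y ≤ 1)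
    (hy : α * (q - 1) ≤ y * (1 - α)) : IsC1Holder α (h.action (skew 0 P)) := by
  have hC := hv.one_le
  have hy0 : 0 ≤ y := (mul_nonneg hα₀.le (by linarith)).trans hy₀
  have hτ : ∀ i (t : ℝ), 0 < rowWidth N i + |t| := fun i t => by
    linarith [one_le_rowWidth N i, abs_nonneg t]
  have hYpos : ∀ i (t : ℝ), 0 < (rowWidth N i + |t|) ^ (-q) := fun i t =>
    Real.rpow_pos_of_pos (hτ i t) _
  -- As `|P i|` is at most `B` times the row width, moving by that much changes `τ` by a bounded
  -- factor only.
  have hshift : ∀ i (s t : ℝ), |s - t| ≤ |(P i : ℝ)| →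
      rowWidth N i + |t| ≤ (1 + B) * (rowWidth N i + |s|) := by
    intro i s t hst
    have h1 := one_le_rowWidth N i
    have h2 : rowWidth N i ^ (1 - y) ≤ rowWidth N i := by
      calc rowWidth N i ^ (1 - y) ≤ rowWidth N i ^ (1 : ℝ) :=
            Real.rpow_le_rpow_of_exponent_le h1 (by linarith)
        _ = _ := Real.rpow_one _
    have h3 : |t| - |s| ≤ |s - t| := by rw [abs_sub_comm]; exact abs_sub_abs_le_abs_sub t s
    have h4 := (hP i).trans (mul_le_mul_of_nonneg_left h2 hB)
    nlinarith [mul_nonneg hB (abs_nonneg s)]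
  have hYshift : ∀ i (s t : ℝ), |s - t| ≤ |(P i : ℝ)| →
      (rowWidth N i + |s|) ^ (-q) ≤ (1 + B) ^ 2 * (rowWidth N i + |t|) ^ (-q) := by
    intro i s t hst
    have h1 : (1 + B) ^ q ≤ (1 + B) ^ 2 := by
      rw [← Real.rpow_natCast]
      exact Real.rpow_le_rpow_of_exponent_le (by linarith) (by simpa using hq)
    have h2 : (rowWidth N i + |t|) ^ q ≤ (1 + B) ^ 2 * (rowWidth N i + |s|) ^ q := by
      refine (Real.rpow_le_rpow (hτ i t).le (hshift i s t hst) (by linarith)).trans ?_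
      rw [Real.mul_rpow (by linarith) (hτ i s).le]
      exact mul_le_mul_of_nonneg_right h1 (Real.rpow_nonneg (hτ i s).le q)
    rw [Real.rpow_neg (hτ i s).le, Real.rpow_neg (hτ i t).le, ← div_eq_mul_inv,
      inv_le_comm₀ (Real.rpow_pos_of_pos (hτ i s) q)
      (div_pos (by positivity) (Real.rpow_pos_of_pos (hτ i t) q)), inv_div,
      div_le_iff₀ (by positivity), mul_comm]
    exact h2
  have hdershift : ∀ i (s t : ℝ), |s - t| ≤ |(P i : ℝ)| → |rhoDeriv v i s| ≤
      C * (1 + B) ^ 3 * ((rowWidth N i + |t|) ^ (-q) / (rowWidth N i + |t|)) := by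
    intro i s t hst
    refine (hv.deriv i s).trans ?_
    rw [mul_assoc C]
    refine mul_le_mul_of_nonneg_left ?_ (by linarith)
    rw [← mul_div_assoc, div_le_div_iff₀ (hτ i s) (hτ i t)]
    calc (rowWidth N i + |s|) ^ (-q) * (rowWidth N i + |t|)
        ≤ ((1 + B) ^ 2 * (rowWidth N i + |t|) ^ (-q)) * ((1 + B) * (rowWidth N i + |s|)) :=
          mul_le_mul (hYshift i s t hst) (hshift i s t hst) (hτ i t).le
            (mul_nonneg (by positivity) (hYpos i t).le)
      _ = _ := by ring
  have hPself : ∀ i (t : ℝ), |t + P i - t| ≤ |(P i : ℝ)| := fun i t => by simp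
  refine isC1Holder_action_of_decay h hv hα₀ hα₁ hq₁ hq (x := y) (y := 1)
    (K := 2 * C ^ 4 * (1 + B) ^ 4) hy₀ (by linarith) (by norm_num) (by norm_num) (by nlinarith)
    (by positivity) (fun i t => ?_) fun i t => ?_
  all_goals
    have hτ0 := hτ i t
    have hY := hYpos i t
    have hρ := h.rho_pos i t
    have hlow := hv.lower i t
    have hup := hv.upper i t
    have hder := hv.deriv i t
    rw [inv_mul_le_iff₀ (by linarith)] at hlow
  · have h1 : |rho v i (t + P i) - rho v i t| ≤ C * (1 + B) ^ 3 *
        ((rowWidth N i + |t|) ^ (-q) / (rowWidth N i + |t|)) * |(P i : ℝ)| := by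
      have := (convex_uIcc t (t + P i)).norm_image_sub_le_of_norm_hasDerivWithin_le
        (f := rho v i) (f' := rhoDeriv v i)
        (C := C * (1 + B) ^ 3 * ((rowWidth N i + |t|) ^ (-q) / (rowWidth N i + |t|)))
        (fun r _ => (hasDerivAt_rho v i r).hasDerivWithinAt) (fun r hr => by
          rw [Real.norm_eq_abs]
          refine hdershift i r t ?_
          have := abs_sub_left_of_mem_uIcc hr
          simpa using this) left_mem_uIcc right_mem_uIcc
      simpa [Real.norm_eq_abs] using this
    have h2 : |(P i : ℝ)| ≤ B * ((rowWidth N i + |t|) * (rowWidth N i + |t|) ^ (-y)) := by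
      refine (hP i).trans (mul_le_mul_of_nonneg_left ?_ hB)
      calc rowWidth N i ^ (1 - y) ≤ (rowWidth N i + |t|) ^ (1 - y) :=
            Real.rpow_le_rpow (by linarith [one_le_rowWidth N i]) (by linarith [abs_nonneg t])
              (by linarith)
        _ = _ := by rw [sub_eq_add_neg, Real.rpow_add hτ0, Real.rpow_one]
    simp only [rhoRatio, add_zero]
    rw [div_sub_one hρ.ne', abs_div, abs_of_pos hρ, div_le_iff₀ hρ]
    have hZ : 0 ≤ (rowWidth N i + |t|) ^ (-y) := Real.rpow_nonneg hτ0.le _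
    set τ := rowWidth N i + |t|
    calc |rho v i (t + P i) - rho v i t| ≤ C * (1 + B) ^ 3 * (τ ^ (-q) / τ) * |(P i : ℝ)| := h1
      _ ≤ C * (1 + B) ^ 3 * (C * rho v i t / τ) * (B * (τ * τ ^ (-y))) := by gcongr
      _ = C ^ 2 * ((1 + B) ^ 3 * B) * (τ ^ (-y) * rho v i t) := by field_simp
      _ ≤ 2 * C ^ 4 * (1 + B) ^ 4 * (τ ^ (-y) * rho v i t) := by
          refine mul_le_mul_of_nonneg_right (mul_le_mul ?_ ?_ (by positivity) (by positivity))
            (by positivity)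
          · have : C ^ 2 ≤ C ^ 4 := pow_le_pow_right₀ hC (by norm_num)
            nlinarith [sq_nonneg C]
          · rw [pow_succ (1 + B) 3]
            exact mul_le_mul_of_nonneg_left (by linarith) (by positivity)
      _ = _ := by ring
  · simp only [add_zero]
    rw [abs_div, abs_of_pos (pow_pos hρ 2), div_le_iff₀ (pow_pos hρ 2)]
    have h1 := hdershift i _ t (hPself i t)
    have h2 : |rho v i (t + P i)| ≤ C * ((1 + B) ^ 2 * (rowWidth N i + |t|) ^ (-q)) :=
      (hv.upper i _).trans (mul_le_mul_of_nonneg_left (hYshift i _ t (hPself i t)) (by linarith))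
    rw [Real.rpow_neg_one]
    refine (abs_sub _ _).trans ?_
    rw [abs_mul, abs_mul]
    set τ := rowWidth N i + |t|
    set Y := τ ^ (-q)
    have hB3 : (1 + B) ^ 2 ≤ (1 + B) ^ 4 := pow_le_pow_right₀ (by linarith) (by norm_num)
    have hB4 : (1 + B) ^ 3 ≤ (1 + B) ^ 4 := pow_le_pow_right₀ (by linarith) (by norm_num)
    calc |rhoDeriv v i (t + P i)| * |rho v i t| + |rho v i (t + P i)| * |rhoDeriv v i t|
        ≤ C * (1 + B) ^ 3 * (Y / τ) * (C * Y) + C * ((1 + B) ^ 2 * Y) * (C * (Y / τ)) := by gcongr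
      _ ≤ C * (1 + B) ^ 4 * (Y / τ) * (C * Y) + C * ((1 + B) ^ 4 * Y) * (C * (Y / τ)) := by gcongr
      _ = 2 * C ^ 2 * (1 + B) ^ 4 * τ⁻¹ * Y ^ 2 := by ring
      _ ≤ 2 * C ^ 2 * (1 + B) ^ 4 * τ⁻¹ * (C * rho v i t) ^ 2 := by gcongr
      _ = _ := by ring

theorem abs_risingBinom_le (k : ℕ) (i : ℤ) :
    |(risingBinom k i : ℝ)| ≤ (k + 1 : ℝ) ^ k * (1 + |(i : ℝ)|) ^ k := by
  have h1 : |(risingBinom k i : ℝ)| ≤ |((k ! : ℤ) : ℝ) * (risingBinom k i : ℝ)| := by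
    rw [abs_mul]
    refine le_mul_of_one_le_left (abs_nonneg _) ?_
    have h2 : (1 : ℝ) ≤ (k ! : ℕ) := by exact_mod_cast Nat.factorial_pos k
    simpa using h2
  refine h1.trans ?_
  rw [← Int.cast_mul, factorial_mul_risingBinom, Int.cast_prod, Finset.abs_prod, ← mul_pow]
  calc ∏ m ∈ Finset.range k, |((i + m : ℤ) : ℝ)|
      ≤ ∏ m ∈ Finset.range k, ((k + 1 : ℝ) * (1 + |(i : ℝ)|)) := by
        refine Finset.prod_le_prod (fun _ _ => abs_nonneg _) fun m hm => ?_
        have h3 : (m : ℝ) ≤ k := by exact_mod_cast (Finset.mem_range.1 hm).le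
        push_cast
        have h4 := abs_add_le (i : ℝ) m
        rw [Nat.abs_cast] at h4
        nlinarith [abs_nonneg (i : ℝ), mul_nonneg (Nat.cast_nonneg k : (0 : ℝ) ≤ k)
          (abs_nonneg (i : ℝ))]
    _ = _ := by simp

/-- The single exponent `y = 1 - n/N` serves all `k ≤ n`; degree `k` in `i` costs only `τ^(k/N)`. -/
theorem abs_risingBinom_le_rowWidth (hN : 1 ≤ N) {k n : ℕ} (hkn : k ≤ n) (i : ℤ) :
    |(risingBinom k i : ℝ)| ≤ ((k + 1 : ℝ) ^ k * 2 ^ (k : ℝ)) *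
      rowWidth N i ^ (1 - (1 - n / N) : ℝ) := by
  refine (abs_risingBinom_le k i).trans ?_
  rw [mul_assoc]
  refine mul_le_mul_of_nonneg_left ?_ (by positivity)
  rw [← Real.rpow_natCast (1 + |(i : ℝ)|)]
  refine (add_one_rpow_le_rowWidth hN (Nat.cast_nonneg k) i le_rfl).trans ?_
  refine mul_le_mul_of_nonneg_left ?_ (by positivity)
  refine Real.rpow_le_rpow_of_exponent_le (one_le_rowWidth N i) ?_
  rw [sub_sub_cancel]
  gcongr

end Regularity

/-! ### Identification of the intervals and choice of exponents -/

section Generators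

theorem block_eq_Icc {p q : ℝ} (h : IsSubdivision (normLength p q)) (i j : ℤ) :
    block p q i j = Icc (embed (normLength p q) (toLex (i, (j : ℝ))))
      (embed (normLength p q) (toLex (i, (j : ℝ) + 1))) := by
  have h1 : blockLeft p q (toLex (i, j)) = leftEnd (normLength p q) (toLex (i, j)) := by
    rw [blockLeft, leftEnd, mass, ← tsum_subtype, ← tsum_div_const]
    rfl
  have h2 : ((j : ℝ) + 1) = ((j + 1 : ℤ) : ℝ) := by push_cast; rfl
  ext x
  rw [block, mem_ofPred_eq, mem_Icc, mem_Icc, ← Subtype.coe_le_coe, ← Subtype.coe_le_coe,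
    h.coe_embed, h.coe_embed, h2, chart_intCast, chart_intCast, h.leftEnd_succ, h1]
  rfl

theorem skew_shift_inv : (skew 1 0)⁻¹ = skew (-1) 0 := by
  rw [skew_inv]
  congr 1

theorem skew_shear_inv (P : ℤ → ℤ) : (skew 0 P)⁻¹ = skew 0 (-P) := by
  rw [skew_inv]
  congr 1
  funext i
  simp

theorem action_mem_diffPlus {v : ℤ ×ₗ ℤ → ℝ} {α : ℝ} (h : IsSubdivision v)
    {Φ : (ℤ ×ₗ ℝ) ≃o (ℤ ×ₗ ℝ)} (h₁ : IsC1Holder α (h.action Φ))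
    (h₂ : IsC1Holder α (h.action Φ⁻¹)) : h.action Φ ∈ DiffPlus α := by
  rw [map_inv] at h₂
  exact ⟨h₁, h₂⟩

/-- Exponents for which the model group acts by `C^{1+α}` diffeomorphisms. -/
theorem exists_exponents {α : ℝ} (hα₀ : 0 < α) (hα₁ : α < 1) (n : ℕ) :
    ∃ (N : ℕ) (q : ℝ), 1 ≤ N ∧ 1 < q ∧ q ≤ 2 ∧ α * (q - 1) = 1 / N ∧
      1 / (N * q) + 1 / q < 1 ∧ 1 < N * q ∧ (1 : ℝ) / N ≤ 1 - n / N ∧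
      (1 : ℝ) / N ≤ (1 - n / N) * (1 - α) := by
  -- The three summands give `1/N ≤ (1 - n/N)(1 - α)` for the shears and `αN ≥ 1`, that is `q ≤ 2`.
  obtain ⟨N, hN⟩ := exists_nat_ge (n + 1 / (1 - α) + 1 / α)
  have hα' : 0 < 1 - α := by linarith
  have h1 : 1 ≤ 1 / (1 - α) := by rw [le_div_iff₀ hα']; linarith
  have h2 : 1 ≤ 1 / α := by rw [le_div_iff₀ hα₀]; linarith
  have hn : (0 : ℝ) ≤ n := Nat.cast_nonneg n
  have hN1 : (1 : ℝ) ≤ N := by linarith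
  have hN0 : (0 : ℝ) < N := by linarith
  have hαN : 1 ≤ α * N := by
    have : 1 / α ≤ N := by linarith
    rwa [div_le_iff₀ hα₀, mul_comm] at this
  have hαN' : 1 ≤ (N - n) * (1 - α) := by
    have : 1 / (1 - α) ≤ N - n := by linarith
    rwa [div_le_iff₀ hα'] at this
  have hpos : 0 < 1 / (α * N) := by positivity
  -- This `q` solves `α(q - 1) = 1/N`. Then `1/p + 1/q = (1 + 1/N)/(1 + 1/(αN))`, which is below `1`
  -- because `α < 1`.
  refine ⟨N, 1 + 1 / (α * N), by exact_mod_cast hN1, by linarith, ?_, ?_, ?_, ?_, ?_, ?_⟩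
  · have : 1 / (α * N) ≤ 1 := by rwa [div_le_one (by positivity)]
    linarith
  · rw [add_sub_cancel_left]
    field_simp
  · have h3 : 1 / (N * (1 + 1 / (α * N))) + 1 / (1 + 1 / (α * N)) =
        (1 + 1 / N) / (1 + 1 / (α * N)) := by
      field_simp
      ring
    rw [h3, div_lt_one (by positivity)]
    have : (1 : ℝ) / N < 1 / (α * N) := by
      refine one_div_lt_one_div_of_lt (by positivity) ?_
      nlinarith
    linarith
  · nlinarith
  · rw [one_sub_div hN0.ne']
    gcongr
    nlinarith
  · rw [one_sub_div hN0.ne', div_mul_eq_mul_div]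
    gcongr

end Generators

end HolderDiff

end

/-! ### Conclusion -/

open HolderDiff in
theorem theoremC (α : ℝ) (hα₀ : 0 < α) (hα₁ : α < 1) (d : ℕ) (hd : 1 ≤ d) :
    ∃ (p q : ℝ) (f : DiffPlus α) (g : Fin d → DiffPlus α) (Γ : Subgroup (DiffPlus α)),
      1 < p ∧ 1 < q ∧ Summable (blockLength p q) ∧
      (∀ i j : ℤ, (f : I ≃o I) '' block p q i j = block p q (i + 1) j) ∧
      (∀ (k : Fin d) (i j : ℤ),
        (g k : I ≃o I) '' block p q i j = block p q i (j + risingBinom k i)) ∧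
      Γ = Subgroup.closure (insert f (Set.range g)) ∧
      IsMetabelian Γ ∧ Group.IsNilpotent Γ ∧ Group.nilpotencyClass Γ = d := by
  obtain ⟨n, rfl⟩ := Nat.exists_eq_succ_of_ne_zero (Nat.one_le_iff_ne_zero.1 hd)
  obtain ⟨N, q, hN, hq₁, hq, hqN, hpq, hp, hy₀, hy⟩ := exists_exponents hα₀ hα₁ n
  have hs : Summable (blockLength (N * q) q) :=
    summable_blockLength (by linarith) (by linarith) hpq
  have h : IsSubdivision (normLength (N * q) q) := isSubdivision_normLength hs hq₁.le hq
  obtain ⟨C, hC⟩ := exists_rowBounds hN hq₁.le hq hs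
  have hf : h.action (skew 1 0) ∈ DiffPlus α := by
    refine action_mem_diffPlus h ?_ ?_
    · exact isC1Holder_action_shift h hC hN hα₀ hα₁ hq₁ hq hqN (by simp)
    · rw [skew_shift_inv]
      exact isC1Holder_action_shift h hC hN hα₀ hα₁ hq₁ hq hqN (by simp)
  have hg : ∀ k : Fin (n + 1), h.action (skew 0 (risingBinom k)) ∈ DiffPlus α := by
    intro k
    have hb := abs_risingBinom_le_rowWidth hN (Nat.lt_succ_iff.1 k.2)
    have hn1 : (1 : ℝ) - n / N ≤ 1 := by
      have : (0 : ℝ) ≤ n / N := by positivity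
      linarith
    refine action_mem_diffPlus h ?_ ?_
    · exact isC1Holder_action_shear h hC hα₀ hα₁ hq₁ hq (by positivity) hb (hqN.trans_le hy₀) hn1
        (hqN.trans_le hy)
    · rw [skew_shear_inv]
      refine isC1Holder_action_shear h hC hα₀ hα₁ hq₁ hq
        (B := (k + 1 : ℝ) ^ (k : ℕ) * 2 ^ ((k : ℕ) : ℝ)) (by positivity) (fun i => ?_)
        (hqN.trans_le hy₀) hn1 (hqN.trans_le hy)
      · rw [Pi.neg_apply, Int.cast_neg, abs_neg]
        exact hb i
  set f : DiffPlus α := ⟨_, hf⟩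
  set g : Fin (n + 1) → DiffPlus α := fun k => ⟨_, hg k⟩
  -- In the homeomorphism group, the closure of the generators is the image of the model group, so
  -- all group properties transfer through two injective homomorphisms.
  have hmap : (Subgroup.closure (insert f (range g))).map (DiffPlus α).subtype =
      (modelGroup (n + 1)).map h.action := by
    rw [modelGroup, MonoidHom.map_closure, MonoidHom.map_closure, image_insert_eq, image_insert_eq,
      ← range_comp, ← range_comp]
    rfl
  obtain ⟨hn, hn'⟩ := modelGroup_nilpotent n
  have hinj := (DiffPlus α).subtype_injective
  obtain ⟨hnil, hclass⟩ : Group.IsNilpotent (Subgroup.closure (insert f (range g))) ∧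
      Group.nilpotencyClass (Subgroup.closure (insert f (range g))) = n + 1 := by
    refine nilpotencyClass_eq_succ ?_ ?_
    · rwa [← lowerCentralSeries_map_eq_bot_iff hinj, hmap,
        lowerCentralSeries_map_eq_bot_iff h.action_injective]
    · rwa [Ne, ← lowerCentralSeries_map_eq_bot_iff hinj, hmap,
        lowerCentralSeries_map_eq_bot_iff h.action_injective]
  refine ⟨N * q, q, f, g, _, hp, hq₁, hs, fun i j => ?_, fun k i j => ?_, rfl, ?_, hnil, hclass⟩
  · rw [block_eq_Icc h, block_eq_Icc h]
    simpa using h.action_image_Icc 1 0 i j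
  · rw [block_eq_Icc h, block_eq_Icc h]
    simpa using h.action_image_Icc 0 (risingBinom k) i j
  · rw [← isMetabelian_map_iff hinj, hmap, isMetabelian_map_iff h.action_injective]
    exact modelGroup_isMetabelian n
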